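/- Let $T$ be an infinite, locally finite tree, and let a group $\mathcal G$ act on $T$ by graph automorphisms, cofinitely: there are finitely many orbits of vertices and of directed edges; $E(T/\mathcal G)$ denotes the set of orbits of directed edges. For directed edges of $T$ write $e^{-1}$ for the reversal of $e$, and $e\to f$ if the head of $e$ is the tail of $f$ and $f\ne e^{-1}$. A *symmetric local operator on $T/\mathcal G$* is here a bounded operator $M$ on $\ell^2(V(T))$, with entries $M_{uv}=\langle\delta_u,M\delta_v\rangle$, such that $\overline M^*=M$ ($M$ is symmetric); $M_{uv}=0$ if $u,v$ are at distance greater than one (local); $M_{uv}\neq0$ if $u,v$ are adjacent (connected); and $M_{gu,gv}=M_{uv}$ for all $g\in\mathcal G$. Write $m_e=M_{uv}$ for $e=(u,v)$ and $m_{vv}=M_{vv}$. If $M$ is invertible (has a bounded inverse), its Green function is $G(u,v)=\langle\delta_u,M^{-1}\delta_v\rangle$. A *ratio system for $M$ on $T/\mathcal G$* is a $\mathcal G$-invariant function $r:E(T)\to\mathbb C\cup\{\infty\}$ on the directed edges of $T$ such that, with $c/\infty=0$: (a) if $r_e\neq 0$, $e=(u,v)$, then $0=m_{vv}+\dfrac{m_{e^{-1}}}{r_e}+\sum_{e':\,e\to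 e'}m_{e'}r_{e'}$; (b) if $r_e=0$, then there is $f$ with $e\to f$ and $r_f=\infty$; (c) if $r_f=\infty$ and $e\to f$, then $r_e=0$ and $r_{f^{-1}}\ne0$. For directed edges $e,f$ of $T$ with $r_e,r_f\neq0$ put $$R_{e,f}=\begin{cases}\sum_{e':\,e\to e'\to f}|m_{e'^{-1}}/m_f|^2 & r_f=\infty,\\ |r_f|^2 & r_f\ne\infty,\ e\to f,\\ 0&\text{otherwise,}\end{cases}$$ and for orbits $a,b\in E(T/\mathcal G)$ on which $r$ is nonzero put $R_{a,b}=\sum_{f\in b}R_{e,f}$ for any $e\in a$. Let $\alpha(r)$ be the spectral radius of the finite matrix $(R_{a,b})$. For an invertible $M$, say that $r$ *arises from the Green function of $M$* if for every directed edge $e=(u,v)$ there is a vertex $w$ such that $u$ lies on the path $[w,v]$ and $G(w,u),G(w,v)$ are not both $0$, and for every such $w$ one has $r_e=G(w,v)/G(w,u)$ (read as $\infty$ if $G(w,u)=0$). **Theorem.** The condition $\alpha(r)<1$ is a classifying condition for $T/\mathcal G$: for every symmetric local operator $M$ on $T/\mathcal G$ as above and every ratio system $r$ for $M$ on $T/\mathcal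 G$, one has $\alpha(r)<1$ if and only if $M$ is invertible and $r$ arises from the Green function of $M$. Moreover, such an $M$ is invertible if and only if it has a ratio system $r$ on $T/\mathcal G$ with $\alpha(r)<1$. -/

import Mathlib

open scoped OnePoint

namespace TreeQuotient

universe u v

variable {V : Type u} {T : SimpleGraph V} {Γ : Type v} [Group Γ]

/-! ### The quotient of a tree by a group action `ρ : Γ →* (T ≃g T)`.
Directed edges of `T` are its darts; the inverse of an edge `e` is `e.symm`. -/

/-- Two vertices lie in the same orbit. -/
def vertexSetoid (ρ : Γ →* (T ≃g T)) : Setoid V where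
  r x y := ∃ g : Γ, ρ g x = y
  iseqv :=
    { refl := fun x => ⟨1, by simp⟩
      symm := by
        rintro x y ⟨g, rfl⟩
        exact ⟨g⁻¹, by simp [← RelIso.mul_apply]⟩
      trans := by
        rintro x y z ⟨g, rfl⟩ ⟨h, rfl⟩
        exact ⟨h * g, by simp [RelIso.mul_apply]⟩ }

/-- Two directed edges lie in the same orbit. -/
def edgeSetoid (ρ : Γ →* (T ≃g T)) : Setoid T.Dart where
  r e f := ∃ g : Γ, ρ g e.fst = f.fst ∧ ρ g e.snd = f.snd
  iseqv :=
    { refl := fun x => ⟨1, by simp⟩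
      symm := by
        rintro x y ⟨g, h1, h2⟩
        exact ⟨g⁻¹, by simp [← h1, ← h2, ← RelIso.mul_apply]⟩
      trans := by
        rintro x y z ⟨g, h1, h2⟩ ⟨h, h3, h4⟩
        exact ⟨h * g, by simp [RelIso.mul_apply, h1, h2, h3, h4]⟩ }

/-- `V(T/Γ)`, the set of orbits of vertices. -/
def VertexOrbit (ρ : Γ →* (T ≃g T)) : Type u := Quotient (vertexSetoid ρ)

/-- `E(T/Γ)`, the set of orbits of directed edges. -/
def EdgeOrbit (ρ : Γ →* (T ≃g T)) : Type u := Quotient (edgeSetoid ρ)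

/-- The orbit of a directed edge. -/
def EdgeOrbit.mk (ρ : Γ →* (T ≃g T)) (e : T.Dart) : EdgeOrbit ρ := Quotient.mk (edgeSetoid ρ) e

/-- A directed edge picked from an orbit. -/
noncomputable def EdgeOrbit.rep {ρ : Γ →* (T ≃g T)} (a : EdgeOrbit ρ) : T.Dart := Quotient.out a

/-! ### Operators on `ℓ²(V)` -/

/-- The complex Hilbert space `ℓ²(V)`. -/
abbrev L2 (V : Type u) : Type u := lp (fun _ : V => ℂ) 2

/-- The Dirac delta function at `x`. -/
noncomputable def delta (x : V) : L2 V :=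
  letI := Classical.decEq V
  lp.single 2 x (1 : ℂ)

/-- The matrix entry `M_{xy} = ⟨δ_x, M δ_y⟩`. -/
noncomputable def entry (M : L2 V →L[ℂ] L2 V) (x y : V) : ℂ :=
  inner ℂ (delta x) (M (delta y))

/-- The adjoint of `M` is its complex conjugate `f ↦ star (M (star f))`,
that is, `M` equals the adjoint of its complex conjugate. -/
def IsSymm (M : L2 V →L[ℂ] L2 V) : Prop :=
  ∀ f : L2 V, ContinuousLinearMap.adjoint M (star f) = star (M f)

/-- `M_{xy} = 0` for `x`, `y` at distance greater than one in `T`. -/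
def IsLocal (T : SimpleGraph V) (M : L2 V →L[ℂ] L2 V) : Prop :=
  ∀ x y : V, 1 < T.dist x y → entry M x y = 0

/-- `M_{xy} ≠ 0` for adjacent `x`, `y`. -/
def IsConn (T : SimpleGraph V) (M : L2 V →L[ℂ] L2 V) : Prop :=
  ∀ x y : V, T.Adj x y → entry M x y ≠ 0

/-- `M` is invariant under the action. -/
def IsInvariantOp (ρ : Γ →* (T ≃g T)) (M : L2 V →L[ℂ] L2 V) : Prop :=
  ∀ (g : Γ) (x y : V), entry M (ρ g x) (ρ g y) = entry M x y

/-- A (connected) symmetric local operator on `T/Γ`. -/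
structure IsOperatorOn (ρ : Γ →* (T ≃g T)) (M : L2 V →L[ℂ] L2 V) : Prop where
  symm : IsSymm M
  isLocal : IsLocal T M
  conn : IsConn T M
  invariant : IsInvariantOp ρ M

/-- The coefficient `m_e = M_{xy}` for the directed edge `e = (x, y)`. -/
noncomputable def coeff (M : L2 V →L[ℂ] L2 V) (e : T.Dart) : ℂ := entry M e.fst e.snd

/-- The Green function `G(x, y) = ⟨δ_x, M⁻¹ δ_y⟩`; it is only used when `M` is invertible. -/
noncomputable def green (M : L2 V →L[ℂ] L2 V) (x y : V) : ℂ := entry (Ring.inverse M) x y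

/-! ### Ratio systems -/

/-- The edge `f` can follow `e` in a non-backtracking walk. -/
def Follows (e f : T.Dart) : Prop := e.snd = f.fst ∧ f ≠ e.symm

/-- The complex value of a finite ratio. The value at `∞` is never relevant. -/
def finiteValue : OnePoint ℂ → ℂ
  | ∞ => 0
  | OnePoint.some z => z

/-- The quotient `c / r`, with `c / ∞ = 0`. -/
noncomputable def divRatio (c : ℂ) : OnePoint ℂ → ℂ
  | ∞ => 0
  | OnePoint.some z => c / z

/-- `r` is a ratio system on `T` for the operator `M`.
The sum has finitely many terms when `T` is locally finite, and, by the third condition, all the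
ratios that occur in it are finite. -/
structure IsRatioSystem (M : L2 V →L[ℂ] L2 V) (r : T.Dart → OnePoint ℂ) : Prop where
  recursion : ∀ e : T.Dart, r e ≠ ((0 : ℂ) : OnePoint ℂ) →
    0 = entry M e.snd e.snd + divRatio (coeff M e.symm) (r e)
      + ∑ᶠ (f : T.Dart) (_ : Follows e f), coeff M f * finiteValue (r f)
  zero : ∀ e : T.Dart, r e = ((0 : ℂ) : OnePoint ℂ) → ∃ f : T.Dart, Follows e f ∧ r f = ∞
  infinite : ∀ e f : T.Dart, r f = ∞ → Follows e f →
    r e = ((0 : ℂ) : OnePoint ℂ) ∧ r f.symm ≠ ((0 : ℂ) : OnePoint ℂ)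

/-- A ratio system on `T/Γ`: a ratio system on `T` that is invariant under `Γ`. -/
structure IsRatioSystemOn (ρ : Γ →* (T ≃g T)) (M : L2 V →L[ℂ] L2 V)
    (r : T.Dart → OnePoint ℂ) : Prop where
  isRatioSystem : IsRatioSystem M r
  invariant : ∀ (g : Γ) (e f : T.Dart), ρ g e.fst = f.fst → ρ g e.snd = f.snd → r f = r e

open Classical in
/-- The entry `R_{e,f}` for directed edges `e`, `f` of `T`. -/
noncomputable def edgeMatrix (M : L2 V →L[ℂ] L2 V) (r : T.Dart → OnePoint ℂ) (e f : T.Dart) : ℝ :=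
  if r f = ∞ then
    ∑ᶠ (d : T.Dart) (_ : Follows e d ∧ Follows d f), ‖coeff M d.symm / coeff M f‖ ^ 2
  else if Follows e f then ‖finiteValue (r f)‖ ^ 2
  else 0

/-- The orbits of directed edges on which the (invariant) function `r` does not vanish. -/
def NonzeroOrbit (ρ : Γ →* (T ≃g T)) (r : T.Dart → OnePoint ℂ) : Type u :=
  {a : EdgeOrbit ρ // r a.rep ≠ ((0 : ℂ) : OnePoint ℂ)}

instance (ρ : Γ →* (T ≃g T)) (r : T.Dart → OnePoint ℂ) [Finite (EdgeOrbit ρ)] :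
    Finite (NonzeroOrbit ρ r) :=
  Subtype.finite

/-- The matrix `R_{a,b} = ∑_{f ∈ b} R_{e,f}`, where `e` is picked from the orbit `a`. -/
noncomputable def quotientMatrix (ρ : Γ →* (T ≃g T)) (M : L2 V →L[ℂ] L2 V)
    (r : T.Dart → OnePoint ℂ) : Matrix (NonzeroOrbit ρ r) (NonzeroOrbit ρ r) ℂ :=
  Matrix.of fun a b =>
    ((∑ᶠ (f : T.Dart) (_ : EdgeOrbit.mk ρ f = b.1), edgeMatrix M r a.1.rep f : ℝ) : ℂ)

open Classical in
/-- The decay rate `α(r)`: the spectral radius of the finite matrix `R` on `T/Γ`. -/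
noncomputable def decayRate (ρ : Γ →* (T ≃g T)) [Finite (EdgeOrbit ρ)] (M : L2 V →L[ℂ] L2 V)
    (r : T.Dart → OnePoint ℂ) : ENNReal :=
  letI := Fintype.ofFinite (NonzeroOrbit ρ r)
  spectralRadius ℂ (quotientMatrix ρ M r)

/-! ### Ratio systems from Green functions -/

/-- In a tree: `y` lies on the unique path from `x` to `z`. -/
def Between (T : SimpleGraph V) (x y z : V) : Prop :=
  ∀ p : T.Walk x z, p.IsPath → y ∈ p.support

open Classical in
/-- The generalized ratio `b / a`, used when `a`, `b` are not both zero. -/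
noncomputable def genRatio (b a : ℂ) : OnePoint ℂ :=
  if a = 0 then ∞ else ((b / a : ℂ) : OnePoint ℂ)

/-- `r` arises from the Green function `G` of `M`: for every directed edge `e = (y, z)`,
the value `r_e` is the common value of the generalized ratios `G(x, z) / G(x, y)` over all `x` such
that `y` lies between `x` and `z` and this ratio exists (and there is such an `x`). -/
def ArisesFromGreen (M : L2 V →L[ℂ] L2 V) (r : T.Dart → OnePoint ℂ) : Prop :=
  ∀ e : T.Dart,
    (∃ x : V, Between T x e.fst e.snd ∧ (green M x e.fst ≠ 0 ∨ green M x e.snd ≠ 0)) ∧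
    ∀ x : V, Between T x e.fst e.snd → (green M x e.fst ≠ 0 ∨ green M x e.snd ≠ 0) →
      r e = genRatio (green M x e.snd) (green M x e.fst)

/-- `C(r, M)` is a classifying condition for `T/Γ`: for every symmetric local operator `M` on `T/Γ`
and every ratio system `r` for `M` on `T/Γ`, the condition `C(r, M)` holds if and only if `M` is
invertible and `r` arises from its Green function. -/
def IsClassifyingCondition (ρ : Γ →* (T ≃g T))
    (C : (T.Dart → OnePoint ℂ) → (L2 V →L[ℂ] L2 V) → Prop) : Prop :=
  ∀ M : L2 V →L[ℂ] L2 V, IsOperatorOn ρ M →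
    ∀ r : T.Dart → OnePoint ℂ, IsRatioSystemOn ρ M r →
      (C r M ↔ IsUnit M ∧ ArisesFromGreen M r)

end TreeQuotient

namespace TreeQuotient

universe u v

variable {V : Type u} {T : SimpleGraph V} {Γ : Type v} [Group Γ]

/-! ### Distances in a tree -/

/-! Suppose first that `M` is invertible. For an edge `e = (u, v)` pointing away from `w`, the
equation `M G(w,·) = δ_w` has no source beyond `e`. Any two such columns have proportional values at
`u`, `v` (`green_mul_green`): otherwise a combination vanishing at `u` but not at `v`, cut off along
`e`, would be a nonzero multiple of `G(u,·)`, and then both products in question would vanish. So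
the Green function has well-defined generalized ratios, and reading the equation at `v` shows that
they form a ratio system.

An infinite ratio on `f` means that the column vanishes at the tail of `f`. The equation at this
zero then determines the value at the head of `f` from the value one step before the zero. Thus a
nonzero `R_{e,f}` is the factor by which `|G(w,·)|²` changes between the heads of `e` and `f`, over
one or two steps (`norm_green_snd`). Disjoint parts of the tree carry disjoint parts of the finite
mass of the column. Hence the infimum `N` over an orbit of the mass beyond an edge, normalized at
its head, satisfies `1 + R N ≤ N`, and a nonnegative finite matrix with such an `N` has spectral
radius less than one.

Conversely, let the spectral radius be less than one and root the tree at `o`. The recursion is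
Gaussian elimination from the ends of the tree towards the root, and it gives `M = (1 - Aᵀ) D (1 -
A)` (`IsFactorization.eq_mul`). Here `A` transports values outwards, from parent to child with
weight `r_e`, or from grandparent to grandchild across a zero. `D` has blocks of size one, and
blocks of size two on the edges with infinite ratio, where the pivot at the head vanishes. The
solution of `N = 1 + R N` gives weights in which `A` is a strict contraction up to similarity, so
the outer factors are invertible (`exists_lower`). All blocks of `D` are invertible with uniform
bounds, except possibly the one at the root.

Some root has an invertible block (`exists_root`). Otherwise all ratios are finite and nonzero with
`r_e r_{e⁻¹} = 1`, and `(1 - A)⁻¹ δ_o` is a square summable function with invariant nonvanishing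
ratios along all edges. Its modulus is constant on orbits, hence bounded below, which is absurd on
an infinite tree.

Once `M` is invertible, the factorization at any root `w` gives `D (1 - A) G(w,·) = δ_w`. The rows
of this equation say that `G(w,·)` has the ratios `r` on all edges pointing away from `w`. -/

lemma dist_adj_cases (hT : T.IsTree) (x : V) {y z : V} (h : T.Adj y z) :
    T.dist x z = T.dist x y + 1 ∨ T.dist x y = T.dist x z + 1 :=
  (hT.dist_eq_dist_add_one_of_adj x h).symm

lemma exists_adj_dist_lt (hT : T.IsTree) {o y : V} (h : y ≠ o) :
    ∃ p, T.Adj p y ∧ T.dist o p < T.dist o y := by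
  obtain ⟨w, hw⟩ := hT.connected.exists_walk_length_eq_dist y o
  cases w with
  | nil => exact absurd rfl h
  | cons hadj w' =>
    rename_i p
    refine ⟨p, hadj.symm, ?_⟩
    have := SimpleGraph.dist_le w'
    rw [SimpleGraph.dist_comm (u := o), SimpleGraph.dist_comm (u := o), ← hw,
      SimpleGraph.Walk.length_cons]
    omega

/-- Both neighbours are the penultimate vertex of the unique path from `o` to `y`. -/
lemma eq_of_adj_dist_lt (hT : T.IsTree) {o a b y : V} (ha : T.Adj a y) (hb : T.Adj b y)
    (hda : T.dist o a < T.dist o y) (hdb : T.dist o b < T.dist o y) : a = b := by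
  classical
  obtain ⟨p, hp, hpl⟩ := hT.connected.exists_path_of_dist o y
  have key : ∀ c, T.Adj c y → T.dist o c < T.dist o y → c = p.penultimate := by
    intro c hc hdc
    refine hT.isAcyclic.eq_penultimate_of_adj_end hp hc.symm ?_
    by_contra hcp
    obtain ⟨q, hq, hql⟩ := hT.connected.exists_path_of_dist o c
    have hyq : y ∉ q.support := by
      intro hy
      have h1 := SimpleGraph.dist_le (q.takeUntil y hy)
      have h2 := q.length_takeUntil_le_length hy
      omega
    have hq' : (q.concat hc).IsPath := hq.concat hyq hc
    have := (hT.existsUnique_path o y).unique hp hq'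
    rw [this] at hcp
    exact hcp (by simp [SimpleGraph.Walk.support_concat])
  rw [key a ha hda, key b hb hdb]

lemma between_iff (hT : T.IsTree) {x y z : V} (h : T.Adj y z) :
    Between T x y z ↔ T.dist x y < T.dist x z := by
  classical
  obtain ⟨p, hp, hpl⟩ := hT.connected.exists_path_of_dist x z
  constructor
  · intro hb
    have hy := hb p hp
    have h1 := SimpleGraph.dist_le (p.takeUntil y hy)
    have h2 := p.length_takeUntil_le_length hy
    have := hT.dist_ne_of_adj x h
    omega
  · intro hlt q hq
    obtain ⟨q', hq', hql'⟩ := hT.connected.exists_path_of_dist x y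
    have hyq : z ∉ q'.support := by
      intro hz
      have h1 := SimpleGraph.dist_le (q'.takeUntil z hz)
      have h2 := q'.length_takeUntil_le_length hz
      omega
    rw [(hT.existsUnique_path x z).unique hq (hq'.concat hyq h)]
    simp [SimpleGraph.Walk.support_concat]

lemma dist_map (φ : T ≃g T) (x y : V) : T.dist (φ x) (φ y) = T.dist x y := by
  have key : ∀ (φ : T ≃g T) (x y : V), T.edist (φ x) (φ y) ≤ T.edist x y := by
    intro φ x y
    rw [SimpleGraph.edist_eq_sInf (u := x)]
    refine le_sInf ?_
    rintro _ ⟨w, rfl⟩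
    simpa using SimpleGraph.edist_le (w.map φ.toHom)
  have h := key φ.symm (φ x) (φ y)
  simp only [RelIso.symm_apply_apply] at h
  rw [SimpleGraph.dist, SimpleGraph.dist, le_antisymm (key φ x y) h]

/-! ### The two sides of an edge -/

/-- The vertices that are separated from the tail of `e` by the edge `e`. -/
def side (e : T.Dart) : Set V := {x | T.dist x e.snd < T.dist x e.fst}

lemma mem_side {e : T.Dart} {x : V} : x ∈ side e ↔ T.dist x e.snd < T.dist x e.fst := Iff.rfl

lemma not_mem_side (hT : T.IsTree) {e : T.Dart} {x : V} :
    x ∉ side e ↔ T.dist x e.fst < T.dist x e.snd := by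
  have := hT.dist_ne_of_adj x e.adj
  rw [mem_side]
  omega

lemma between_iff_not_mem_side (hT : T.IsTree) {e : T.Dart} {x : V} :
    Between T x e.fst e.snd ↔ x ∉ side e := by
  rw [between_iff hT e.adj, not_mem_side hT]

lemma snd_mem_side (e : T.Dart) : e.snd ∈ side e := by
  rw [mem_side, SimpleGraph.dist_self, SimpleGraph.dist_eq_one_iff_adj.2 e.adj.symm]
  exact one_pos

lemma fst_not_mem_side (e : T.Dart) : e.fst ∉ side e := by
  rw [mem_side, SimpleGraph.dist_self]
  exact Nat.not_lt_zero _

lemma mem_side_symm (hT : T.IsTree) {e : T.Dart} {x : V} : x ∈ side e.symm ↔ x ∉ side e := by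
  rw [not_mem_side hT, mem_side]
  rfl

/-- The edge `e` is the only bridge between its sides. If `x` were not the head of `e`, then `y` and
the next vertex from `x` towards `e.snd` would both be neighbours of `x` nearer to `e.fst`, hence
equal, although `y` is farther from `e.snd`. -/
lemma eq_of_adj_side (hT : T.IsTree) {e : T.Dart} {x y : V} (h : T.Adj x y) (hx : x ∈ side e)
    (hy : y ∉ side e) : x = e.snd ∧ y = e.fst := by
  rw [not_mem_side hT] at hy
  rw [mem_side] at hx
  have h1 := dist_adj_cases hT x e.adj
  have h2 := dist_adj_cases hT y e.adj
  have h3 := dist_adj_cases hT e.snd h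
  have h4 := dist_adj_cases hT e.fst h
  rw [SimpleGraph.dist_comm (v := x), SimpleGraph.dist_comm (v := y)] at h3 h4
  by_cases hn : x = e.snd
  · refine ⟨hn, ?_⟩
    have : T.dist x e.snd = 0 := by rw [hn, SimpleGraph.dist_self]
    exact hT.connected.dist_eq_zero_iff.1 (by omega)
  · exfalso
    obtain ⟨x', hx', hd⟩ := exists_adj_dist_lt hT hn
    have h5 := hT.connected.dist_triangle (u := e.fst) (v := e.snd) (w := x')
    rw [SimpleGraph.dist_eq_one_iff_adj.2 e.adj] at h5
    have hyx : y = x' := by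
      refine eq_of_adj_dist_lt hT (o := e.fst) h.symm hx' ?_ ?_ <;>
      rw [SimpleGraph.dist_comm (u := e.fst) (v := x)]
      · rw [SimpleGraph.dist_comm]; omega
      · rw [SimpleGraph.dist_comm (u := e.snd) (v := x)] at hd; omega
    subst hyx
    rw [SimpleGraph.dist_comm (u := e.snd) (v := x), SimpleGraph.dist_comm (u := e.snd)] at hd
    omega

/-- Both heads are the neighbour of the common tail that is nearer to `x`. -/
lemma eq_of_mem_side {e f : T.Dart} (hT : T.IsTree) (h : e.fst = f.fst) {x : V} (he : x ∈ side e)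
    (hf : x ∈ side f) : e = f := by
  refine SimpleGraph.Dart.ext _ _ (Prod.ext h ?_)
  exact eq_of_adj_dist_lt hT (o := x) e.adj.symm (by rw [h]; exact f.adj.symm) he
    (by rw [h]; exact hf)

lemma Follows.snd_not_mem_side {e f : T.Dart} (h : Follows e f) : e.snd ∉ side f := by
  rw [h.1]; exact fst_not_mem_side f

lemma Follows.side_subset (hT : T.IsTree) {e f : T.Dart} (h : Follows e f) : side f ⊆ side e := by
  intro x hx
  by_contra hxe
  rw [← mem_side_symm hT] at hxe
  exact h.2 (eq_of_mem_side hT h.1.symm hx hxe)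

lemma Follows.snd_mem_side (hT : T.IsTree) {e f : T.Dart} (h : Follows e f) : f.snd ∈ side e :=
  h.side_subset hT (TreeQuotient.snd_mem_side f)

lemma Follows.not_trans {e f d : T.Dart} (h1 : Follows e d) (h2 : Follows d f) :
    ¬ Follows e f := by
  intro h
  have : d.fst = f.fst := h1.1.symm.trans h.1
  exact absurd (h2.1.trans this.symm) d.snd_ne_fst

lemma follows_mk {e : T.Dart} {x : V} (h : T.Adj e.snd x) (hx : x ≠ e.fst) :
    Follows e ⟨(e.snd, x), h⟩ := by
  refine ⟨rfl, fun h' => hx ?_⟩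
  exact congrArg (fun d : T.Dart => d.snd) h'

lemma Follows.snd_ne {e f : T.Dart} (h : Follows e f) : f.snd ≠ e.fst := by
  intro h'
  exact h.2 (SimpleGraph.Dart.ext _ _ (Prod.ext h.1.symm h'))

lemma Follows.adj {e f : T.Dart} (h : Follows e f) : T.Adj e.snd f.snd := by
  rw [h.1]; exact f.adj

lemma dart_ext {e f : T.Dart} (h1 : e.fst = f.fst) (h2 : e.snd = f.snd) : e = f :=
  SimpleGraph.Dart.ext _ _ (Prod.ext h1 h2)

/-! ### The action on darts -/

/-- The image of a dart under an automorphism. -/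
def mapDart (φ : T ≃g T) (e : T.Dart) : T.Dart :=
  ⟨(φ e.fst, φ e.snd), φ.map_rel_iff.2 e.adj⟩

@[simp] lemma mapDart_fst (φ : T ≃g T) (e : T.Dart) : (mapDart φ e).fst = φ e.fst := rfl

@[simp] lemma mapDart_snd (φ : T ≃g T) (e : T.Dart) : (mapDart φ e).snd = φ e.snd := rfl

@[simp] lemma mapDart_symm (φ : T ≃g T) (e : T.Dart) :
    (mapDart φ e).symm = mapDart φ e.symm := rfl

/-- Automorphisms permute the darts. -/
def dartEquiv (φ : T ≃g T) : T.Dart ≃ T.Dart where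
  toFun := mapDart φ
  invFun := mapDart φ.symm
  left_inv e := dart_ext (by simp) (by simp)
  right_inv e := dart_ext (by simp) (by simp)

@[simp] lemma dartEquiv_apply (φ : T ≃g T) (e : T.Dart) : dartEquiv φ e = mapDart φ e := rfl

lemma follows_map (φ : T ≃g T) {e f : T.Dart} :
    Follows (mapDart φ e) (mapDart φ f) ↔ Follows e f := by
  refine and_congr φ.injective.eq_iff (not_congr ?_)
  rw [mapDart_symm]
  exact (dartEquiv φ).injective.eq_iff

lemma mem_side_map (φ : T ≃g T) {e : T.Dart} {x : V} :
    φ x ∈ side (mapDart φ e) ↔ x ∈ side e := by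
  simp only [mem_side, mapDart_fst, mapDart_snd, dist_map]

lemma exists_mapDart_of_mk_eq {ρ : Γ →* (T ≃g T)} {e f : T.Dart}
    (h : EdgeOrbit.mk ρ e = EdgeOrbit.mk ρ f) : ∃ g, mapDart (ρ g) e = f := by
  obtain ⟨g, h1, h2⟩ := Quotient.exact h
  exact ⟨g, dart_ext h1 h2⟩

lemma mk_mapDart (ρ : Γ →* (T ≃g T)) (g : Γ) (e : T.Dart) :
    EdgeOrbit.mk ρ (mapDart (ρ g) e) = EdgeOrbit.mk ρ e :=
  (Quotient.sound (s := edgeSetoid ρ) ⟨g, rfl, rfl⟩ : _ = _).symm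

lemma mk_rep {ρ : Γ →* (T ≃g T)} (a : EdgeOrbit ρ) : EdgeOrbit.mk ρ a.rep = a :=
  Quotient.out_eq (s := edgeSetoid ρ) a

/-- An invariant function on darts takes finitely many values. -/
lemma finite_range_of_invariant (ρ : Γ →* (T ≃g T)) [Finite (EdgeOrbit ρ)] {α : Type*}
    (F : T.Dart → α) (hF : ∀ g e, F (mapDart (ρ g) e) = F e) : (Set.range F).Finite := by
  have : Set.range F ⊆ Set.range (fun a : EdgeOrbit ρ => F a.rep) := by
    rintro _ ⟨e, rfl⟩
    obtain ⟨g, hg⟩ := exists_mapDart_of_mk_eq (mk_rep (EdgeOrbit.mk ρ e))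
    exact ⟨EdgeOrbit.mk ρ e, (hF g _).symm.trans (congrArg F hg)⟩
  exact (Set.finite_range _).subset this

lemma bounded_of_invariant (ρ : Γ →* (T ≃g T)) [Finite (EdgeOrbit ρ)]
    (F : T.Dart → ℝ) (hF : ∀ g e, F (mapDart (ρ g) e) = F e) : ∃ C, ∀ e, F e ≤ C := by
  obtain ⟨C, hC⟩ := (finite_range_of_invariant ρ F hF).bddAbove
  exact ⟨C, fun e => hC ⟨e, rfl⟩⟩

lemma finite_follows (hlf : ∀ x : V, (T.neighborSet x).Finite) (e : T.Dart) :
    {f : T.Dart | Follows e f}.Finite := by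
  refine Set.Finite.of_finite_image (f := fun f : T.Dart => f.snd)
    ((hlf e.snd).subset ?_) ?_
  · rintro _ ⟨f, hf, rfl⟩
    exact hf.adj
  · intro f hf f' hf' h
    exact dart_ext (hf.1.symm.trans hf'.1) h

lemma exists_degree_bound (hlf : ∀ x : V, (T.neighborSet x).Finite) (ρ : Γ →* (T ≃g T))
    [Finite (VertexOrbit ρ)] : ∃ d : ℕ, ∀ x, (hlf x).toFinset.card ≤ d := by
  let n : VertexOrbit ρ → ℕ := fun a => (T.neighborSet (Quotient.out a)).ncard
  obtain ⟨d, hd⟩ := (Set.finite_range n).bddAbove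
  refine ⟨d, fun x => ?_⟩
  obtain ⟨g, hg⟩ := Quotient.exact (Quotient.out_eq (s := vertexSetoid ρ) (Quotient.mk _ x))
  refine le_trans ?_ (hd ⟨Quotient.mk _ x, rfl⟩)
  rw [← Set.ncard_eq_toFinset_card _ (hlf x)]
  have : T.neighborSet x =
      ρ g '' T.neighborSet (Quotient.out (s := vertexSetoid ρ) (Quotient.mk _ x)) := by
    ext y
    simp only [SimpleGraph.mem_neighborSet, Set.mem_image]
    constructor
    · intro h
      refine ⟨(ρ g).symm y, ?_, by simp⟩
      rw [← (ρ g).map_adj_iff]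
      simpa [hg] using h
    · rintro ⟨z, hz, rfl⟩
      rw [← hg]
      exact (ρ g).map_adj_iff.2 hz
  rw [this]
  exact Set.ncard_image_le (hlf _)

/-! ### Square summable functions -/

lemma memlp_two_of_sum_le {f : V → ℂ} {C : ℝ} (h : ∀ F : Finset V, ∑ x ∈ F, ‖f x‖ ^ 2 ≤ C) :
    Memℓp f 2 := by
  refine memℓp_gen' (C := C) fun F => ?_
  simpa using h F

lemma norm_sq_eq_tsum (f : L2 V) : ‖f‖ ^ 2 = ∑' x, ‖f x‖ ^ 2 := by
  simpa using lp.norm_rpow_eq_tsum (p := 2) (by simp) f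

lemma summable_norm_sq (f : L2 V) : Summable fun x => ‖f x‖ ^ 2 := by
  simpa using (lp.memℓp f).summable (p := 2) (by simp)

lemma sum_norm_sq_le (f : L2 V) (F : Finset V) : ∑ x ∈ F, ‖f x‖ ^ 2 ≤ ‖f‖ ^ 2 := by
  rw [norm_sq_eq_tsum]
  exact (summable_norm_sq f).sum_le_tsum F (fun _ _ => sq_nonneg _)

lemma norm_sq_le_of_sum_le {f : L2 V} {C : ℝ} (h : ∀ F : Finset V, ∑ x ∈ F, ‖f x‖ ^ 2 ≤ C) :
    ‖f‖ ^ 2 ≤ C := by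
  rw [norm_sq_eq_tsum]
  exact (summable_norm_sq f).tsum_le_of_sum_le h

/-- The restriction of a square summable function to a set. -/
noncomputable def cutoff (s : Set V) (f : L2 V) : L2 V :=
  ⟨s.indicator f, memlp_two_of_sum_le (C := ‖f‖ ^ 2) fun F => by
    refine le_trans (Finset.sum_le_sum fun x _ => ?_) (sum_norm_sq_le f F)
    gcongr
    exact norm_indicator_le_norm_self _ _⟩

lemma cutoff_of_mem {s : Set V} {x : V} (f : L2 V) (h : x ∈ s) : cutoff s f x = f x :=
  Set.indicator_of_mem h _

lemma cutoff_of_notMem {s : Set V} {x : V} (f : L2 V) (h : x ∉ s) : cutoff s f x = 0 :=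
  Set.indicator_of_notMem h _

lemma delta_self (x : V) : delta x x = 1 := by
  classical
  simp [delta]

lemma delta_of_ne {x y : V} (h : y ≠ x) : delta x y = 0 := by
  classical
  simp [delta, h]

open Classical in
lemma delta_apply (x y : V) : delta x y = if y = x then 1 else 0 := by
  split_ifs with h
  · rw [h, delta_self]
  · exact delta_of_ne h

lemma inner_delta (x : V) (f : L2 V) : inner ℂ (delta x) f = f x := by
  classical
  rw [delta, lp.inner_single_left]
  simp

lemma entry_eq (M : L2 V →L[ℂ] L2 V) (x y : V) : entry M x y = M (delta y) x :=
  inner_delta _ _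

lemma star_delta (x : V) : star (delta x) = delta x := by
  ext y
  rw [lp.star_apply, delta_apply]
  split_ifs <;> simp

lemma L2_ext {f g : L2 V} (h : ∀ x, f x = g x) : f = g := lp.ext (funext h)

lemma clm_ext {M N : L2 V →L[ℂ] L2 V} (h : ∀ x, M (delta x) = N (delta x)) : M = N := by
  classical
  refine lp.ext_continuousLinearMap (by simp) fun i => ?_
  ext1
  simpa [delta] using h i

lemma norm_entry_le (M : L2 V →L[ℂ] L2 V) (x y : V) : ‖entry M x y‖ ≤ ‖M‖ := by
  classical
  have h : ∀ x : V, ‖delta x‖ = 1 := fun x => by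
    rw [delta, lp.norm_single (by simp)]; simp
  calc ‖entry M x y‖ ≤ ‖delta x‖ * ‖M (delta y)‖ := norm_inner_le_norm _ _
    _ ≤ ‖delta x‖ * (‖M‖ * ‖delta y‖) := by gcongr; exact M.le_opNorm _
    _ = ‖M‖ := by rw [h, h]; ring

/-! ### Weighted composition operators -/

/-- The fibres of `q` partition `V`, so `‖A f‖²` is the sum over `v` of `‖f v‖²` times the sum of
`‖t y‖²` over the fibre of `v`. -/
lemma exists_weightedComp (t : V → ℂ) (q : V → V) {C : ℝ} (hC : 0 ≤ C)
    (h : ∀ (v : V) (F : Finset V), (∀ y ∈ F, q y = v) → ∑ y ∈ F, ‖t y‖ ^ 2 ≤ C) :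
    ∃ A : L2 V →L[ℂ] L2 V, (∀ f y, A f y = t y * f (q y)) ∧ ‖A‖ ≤ √C := by
  classical
  have key : ∀ (f : L2 V) (F : Finset V), ∑ y ∈ F, ‖t y * f (q y)‖ ^ 2 ≤ C * ‖f‖ ^ 2 := by
    intro f F
    calc ∑ y ∈ F, ‖t y * f (q y)‖ ^ 2
        = ∑ v ∈ F.image q, ∑ y ∈ F with q y = v, ‖t y * f (q y)‖ ^ 2 :=
          (Finset.sum_fiberwise_of_maps_to (fun y hy => Finset.mem_image_of_mem q hy) _).symm
      _ = ∑ v ∈ F.image q, (∑ y ∈ F with q y = v, ‖t y‖ ^ 2) * ‖f v‖ ^ 2 := by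
          refine Finset.sum_congr rfl fun v _ => ?_
          rw [Finset.sum_mul]
          refine Finset.sum_congr rfl fun y hy => ?_
          rw [(Finset.mem_filter.1 hy).2, norm_mul, mul_pow]
      _ ≤ ∑ v ∈ F.image q, C * ‖f v‖ ^ 2 := by
          gcongr with v
          exact h v _ fun y hy => (Finset.mem_filter.1 hy).2
      _ ≤ C * ‖f‖ ^ 2 := by
          rw [← Finset.mul_sum]
          gcongr
          exact sum_norm_sq_le f _
  let L : L2 V →ₗ[ℂ] L2 V :=
    { toFun := fun f => ⟨fun y => t y * f (q y), memlp_two_of_sum_le (key f)⟩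
      map_add' := fun f g => L2_ext fun x => mul_add (t x) (f (q x)) (g (q x))
      map_smul' := fun c f => L2_ext fun x => mul_left_comm (t x) c (f (q x)) }
  have hL : ∀ f, ‖L f‖ ≤ √C * ‖f‖ := by
    intro f
    refine le_of_sq_le_sq ?_ (by positivity)
    rw [mul_pow, Real.sq_sqrt hC]
    exact norm_sq_le_of_sum_le (key f)
  exact ⟨L.mkContinuous _ hL, fun f y => rfl, L.mkContinuous_norm_le (Real.sqrt_nonneg _) hL⟩

/-! ### Symmetric local operators -/

namespace IsOperatorOn

variable {ρ : Γ →* (T ≃g T)} {M : L2 V →L[ℂ] L2 V}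

lemma inner_star_apply (hs : IsSymm M) (f k : L2 V) :
    inner ℂ (star f) (M k) = inner ℂ (star (M f)) k := by
  rw [← ContinuousLinearMap.adjoint_inner_left, hs f]

lemma entry_comm (hM : IsOperatorOn ρ M) (x y : V) : entry M x y = entry M y x := by
  have h := inner_star_apply hM.symm (delta x) (delta y)
  rw [star_delta, inner_delta, ← inner_conj_symm, inner_delta, lp.star_apply] at h
  simpa [entry_eq] using h

/-- By symmetry, evaluating `M f` at `x` is pairing `f` with the conjugate of the column `M δ_x`,
which by locality is a finite combination of delta functions. -/
lemma apply_eq (hT : T.IsTree) (hlf : ∀ x : V, (T.neighborSet x).Finite) (hM : IsOperatorOn ρ M)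
    (f : L2 V) (x : V) :
    M f x = entry M x x * f x + ∑ y ∈ (hlf x).toFinset, entry M x y * f y := by
  classical
  have h := inner_star_apply hM.symm (delta x) f
  rw [star_delta, inner_delta] at h
  have h2 : star (M (delta x)) = star (entry M x x) • delta x +
      ∑ y ∈ (hlf x).toFinset, star (entry M x y) • delta y := by
    refine L2_ext fun z => ?_
    simp only [lp.star_apply, lp.coeFn_add, Pi.add_apply, lp.coeFn_smul, Pi.smul_apply,
      lp.coeFn_sum, Finset.sum_apply, delta_apply, smul_eq_mul, mul_ite, mul_one, mul_zero]
    rw [← entry_eq, hM.entry_comm z x, Finset.sum_ite_eq]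
    by_cases hz : z = x
    · subst hz; simp
    · by_cases hadj : T.Adj x z
      · simp [hz, hadj]
      · rw [hM.isLocal x z (hT.connected.one_lt_dist_of_ne_of_not_adj (Ne.symm hz) hadj)]
        simp [hz, hadj]
  rw [h, h2, inner_add_left, sum_inner, inner_smul_left, inner_delta]
  simp [inner_smul_left, inner_delta]

lemma apply_delta (hT : T.IsTree) (hlf : ∀ x : V, (T.neighborSet x).Finite)
    (hM : IsOperatorOn ρ M) (x : V) :
    M (delta x) = entry M x x • delta x + ∑ y ∈ (hlf x).toFinset, entry M x y • delta y := by
  classical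
  refine L2_ext fun z => ?_
  simp only [lp.coeFn_add, Pi.add_apply, lp.coeFn_smul, Pi.smul_apply,
    lp.coeFn_sum, Finset.sum_apply, delta_apply, smul_eq_mul, mul_ite, mul_one, mul_zero]
  rw [← entry_eq, hM.entry_comm z x, Finset.sum_ite_eq]
  by_cases hz : z = x
  · subst hz; simp
  · by_cases hadj : T.Adj x z
    · simp [hz, hadj]
    · rw [hM.isLocal x z (hT.connected.one_lt_dist_of_ne_of_not_adj (Ne.symm hz) hadj)]
      simp [hz, hadj]

lemma coeff_ne_zero (hM : IsOperatorOn ρ M) (e : T.Dart) : coeff M e ≠ 0 := hM.conn _ _ e.adj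

lemma coeff_symm (hM : IsOperatorOn ρ M) (e : T.Dart) : coeff M e.symm = coeff M e :=
  hM.entry_comm _ _

lemma coeff_map (hM : IsOperatorOn ρ M) (g : Γ) (e : T.Dart) :
    coeff M (mapDart (ρ g) e) = coeff M e := hM.invariant g _ _

end IsOperatorOn

/-! ### Sums over the edges that follow an edge -/

/-- The darts that follow `e`. -/
noncomputable def nextDarts (hlf : ∀ x : V, (T.neighborSet x).Finite) (e : T.Dart) :
    Finset T.Dart := (finite_follows hlf e).toFinset

lemma mem_nextDarts {hlf : ∀ x : V, (T.neighborSet x).Finite} {e f : T.Dart} :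
    f ∈ nextDarts hlf e ↔ Follows e f := by
  simp [nextDarts]

lemma finsum_follows {E : Type*} [AddCommMonoid E] (hlf : ∀ x : V, (T.neighborSet x).Finite)
    (e : T.Dart) (φ : T.Dart → E) :
    ∑ᶠ (f : T.Dart) (_ : Follows e f), φ f = ∑ f ∈ nextDarts hlf e, φ f :=
  finsum_mem_eq_finite_toFinset_sum φ (finite_follows hlf e)

lemma sum_neighbors_eq {E : Type*} [AddCommMonoid E] (hlf : ∀ x : V, (T.neighborSet x).Finite)
    (e : T.Dart) (φ : V → E) :
    ∑ y ∈ (hlf e.snd).toFinset, φ y = φ e.fst + ∑ f ∈ nextDarts hlf e, φ f.snd := by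
  classical
  have h : (hlf e.snd).toFinset = insert e.fst ((nextDarts hlf e).image fun f => f.snd) := by
    ext y
    simp only [Set.Finite.mem_toFinset, SimpleGraph.mem_neighborSet, Finset.mem_insert,
      Finset.mem_image, mem_nextDarts]
    constructor
    · intro hy
      by_cases hye : y = e.fst
      · exact Or.inl hye
      · exact Or.inr ⟨_, follows_mk hy hye, rfl⟩
    · rintro (rfl | ⟨f, hf, rfl⟩)
      · exact e.adj.symm
      · exact hf.adj
  rw [h, Finset.sum_insert, Finset.sum_image]
  · intro f hf f' hf' h
    rw [Finset.mem_coe, mem_nextDarts] at hf hf'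
    exact dart_ext (hf.1.symm.trans hf'.1) h
  · intro hmem
    obtain ⟨f, hf, h⟩ := Finset.mem_image.1 hmem
    exact (mem_nextDarts.1 hf).snd_ne h

namespace IsOperatorOn

variable {ρ : Γ →* (T ≃g T)} {M : L2 V →L[ℂ] L2 V}

lemma apply_snd (hT : T.IsTree) (hlf : ∀ x : V, (T.neighborSet x).Finite) (hM : IsOperatorOn ρ M)
    (g : L2 V) (e : T.Dart) :
    M g e.snd = entry M e.snd e.snd * g e.snd + coeff M e.symm * g e.fst
      + ∑ f ∈ nextDarts hlf e, coeff M f * g f.snd := by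
  rw [hM.apply_eq hT hlf, sum_neighbors_eq hlf e fun y => entry M e.snd y * g y, ← add_assoc]
  congr 1
  refine Finset.sum_congr rfl fun f hf => ?_
  rw [(mem_nextDarts.1 hf).1]
  rfl

lemma apply_comp (hT : T.IsTree) (hlf : ∀ x : V, (T.neighborSet x).Finite)
    (hM : IsOperatorOn ρ M) (γ : Γ) {g k : L2 V} (hk : ∀ x, k x = g (ρ γ x)) (x : V) :
    M k x = M g (ρ γ x) := by
  classical
  rw [hM.apply_eq hT hlf, hM.apply_eq hT hlf, hM.invariant, hk]
  congr 1
  have h : (hlf (ρ γ x)).toFinset = (hlf x).toFinset.image (ρ γ) := by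
    ext y
    simp only [Set.Finite.mem_toFinset, SimpleGraph.mem_neighborSet, Finset.mem_image]
    constructor
    · intro h
      exact ⟨(ρ γ).symm y, by rw [← (ρ γ).map_adj_iff]; simpa using h, by simp⟩
    · rintro ⟨z, hz, rfl⟩
      exact (ρ γ).map_adj_iff.2 hz
  rw [h, Finset.sum_image (fun a _ b _ hab => (ρ γ).injective hab)]
  exact Finset.sum_congr rfl fun y _ => by rw [hM.invariant, hk]

/-- Only `e` joins the two sides. Inside, the cutoff loses just the value at `e.fst`, which is zero;
outside, only `e.fst` has a neighbour where the cutoff can be nonzero. -/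
lemma apply_cutoff (hT : T.IsTree) (hlf : ∀ x : V, (T.neighborSet x).Finite)
    (hM : IsOperatorOn ρ M) {e : T.Dart} {g : L2 V} (hg : ∀ x ∈ side e, M g x = 0)
    (hu : g e.fst = 0) : M (cutoff (side e) g) = (coeff M e * g e.snd) • delta e.fst := by
  refine L2_ext fun x => ?_
  rw [lp.coeFn_smul, Pi.smul_apply, smul_eq_mul]
  by_cases hx : x ∈ side e
  · rw [delta_of_ne (ne_of_mem_of_not_mem hx (fst_not_mem_side e)), mul_zero, ← hg x hx,
      hM.apply_eq hT hlf, hM.apply_eq hT hlf, cutoff_of_mem _ hx]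
    congr 1
    refine Finset.sum_congr rfl fun y hy => ?_
    by_cases hys : y ∈ side e
    · rw [cutoff_of_mem _ hys]
    · rw [cutoff_of_notMem _ hys, (eq_of_adj_side hT (by simpa using hy) hx hys).2, hu]
  · rw [hM.apply_eq hT hlf, cutoff_of_notMem _ hx, mul_zero, zero_add]
    by_cases hxu : x = e.fst
    · subst hxu
      rw [delta_self, mul_one, Finset.sum_eq_single e.snd]
      · rw [cutoff_of_mem _ (snd_mem_side e)]; rfl
      · intro y hy hne
        have hys : y ∉ side e := fun hys =>
          hne (eq_of_adj_side hT (SimpleGraph.Adj.symm (by simpa using hy)) hys hx).1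
        rw [cutoff_of_notMem _ hys, mul_zero]
      · intro h
        exact absurd (by simp) h
    · rw [delta_of_ne hxu, mul_zero]
      refine Finset.sum_eq_zero fun y hy => ?_
      have hys : y ∉ side e := fun hys =>
        hxu (eq_of_adj_side hT (SimpleGraph.Adj.symm (by simpa using hy)) hys hx).2
      rw [cutoff_of_notMem _ hys, mul_zero]

end IsOperatorOn

/-! ### The Green function -/

/-- The column `M⁻¹ δ_x` of the Green function. -/
noncomputable def greenCol (M : L2 V →L[ℂ] L2 V) (x : V) : L2 V := Ring.inverse M (delta x)

section Green

variable {ρ : Γ →* (T ≃g T)} {M : L2 V →L[ℂ] L2 V}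

lemma inverse_apply_self (hU : IsUnit M) (f : L2 V) : Ring.inverse M (M f) = f := by
  have := congrArg (fun A : L2 V →L[ℂ] L2 V => A f) (Ring.inverse_mul_cancel M hU)
  exact this

lemma apply_greenCol (hU : IsUnit M) (x : V) : M (greenCol M x) = delta x := by
  have := congrArg (fun A : L2 V →L[ℂ] L2 V => A (delta x)) (Ring.mul_inverse_cancel M hU)
  exact this

lemma eq_of_apply_eq (hU : IsUnit M) {f g : L2 V} (h : M f = M g) : f = g := by
  rw [← inverse_apply_self hU f, h, inverse_apply_self hU g]

lemma eq_smul_greenCol (hU : IsUnit M) {f : L2 V} {c : ℂ} {x : V} (h : M f = c • delta x) :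
    f = c • greenCol M x :=
  eq_of_apply_eq hU (by rw [h, map_smul, apply_greenCol hU])

lemma green_comm (hM : IsOperatorOn ρ M) (hU : IsUnit M) (x y : V) :
    green M x y = green M y x := by
  have h := IsOperatorOn.inner_star_apply hM.symm (greenCol M x) (greenCol M y)
  rw [apply_greenCol hU, apply_greenCol hU, star_delta, inner_delta, ← inner_conj_symm,
    inner_delta, lp.star_apply] at h
  rw [green, green, entry_eq, entry_eq]
  simpa [greenCol] using h.symm

lemma green_eq (hM : IsOperatorOn ρ M) (hU : IsUnit M) (x y : V) :
    green M x y = greenCol M x y := by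
  rw [green_comm hM hU, green, entry_eq]
  rfl

/-- Composition with `ρ γ` commutes with `M`, so it turns the column at `ρ γ x` into a solution of
the equation that defines the column at `x`. -/
lemma green_map (hT : T.IsTree) (hlf : ∀ x : V, (T.neighborSet x).Finite)
    (hM : IsOperatorOn ρ M) (hU : IsUnit M) (γ : Γ) (x y : V) :
    green M (ρ γ x) (ρ γ y) = green M x y := by
  obtain ⟨S, hS, -⟩ := exists_weightedComp (V := V) (fun _ => 1) (ρ γ) (C := 1) zero_le_one (by
    intro v F hF
    have : F.card ≤ 1 := Finset.card_le_one.2 fun a ha b hb =>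
      (ρ γ).injective ((hF a ha).trans (hF b hb).symm)
    simpa using this)
  have h : S (greenCol M (ρ γ x)) = greenCol M x := by
    refine eq_of_apply_eq hU (L2_ext fun z => ?_)
    rw [hM.apply_comp hT hlf γ (g := greenCol M (ρ γ x)) (fun x => by rw [hS, one_mul]),
      apply_greenCol hU, apply_greenCol hU]
    by_cases hz : z = x
    · rw [hz, delta_self, delta_self]
    · rw [delta_of_ne hz, delta_of_ne fun h => hz ((ρ γ).injective h)]
  rw [green_eq hM hU, green_eq hM hU, ← h, hS, one_mul]

/-- Otherwise, with symmetry, the column at `u = e.fst` vanishes at `u` and at all its neighbours,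
contradicting `(M G(u,·))(u) = 1`. -/
lemma exists_green_ne_zero (hT : T.IsTree) (hlf : ∀ x : V, (T.neighborSet x).Finite)
    (hM : IsOperatorOn ρ M) (hU : IsUnit M) (e : T.Dart) :
    ∃ w ∉ side e, green M w e.fst ≠ 0 ∨ green M w e.snd ≠ 0 := by
  by_contra! h
  have h1 := hM.apply_snd hT hlf (greenCol M e.fst) e.symm
  rw [apply_greenCol hU, show e.symm.snd = e.fst from rfl, show e.symm.fst = e.snd from rfl,
    delta_self, ← green_eq hM hU, ← green_eq hM hU, (h _ (fst_not_mem_side e)).1,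
    (h _ (fst_not_mem_side e)).2, Finset.sum_eq_zero] at h1
  · simp at h1
  · intro f hf
    have h2 := (mem_nextDarts.1 hf).snd_mem_side hT
    rw [← green_eq hM hU, green_comm hM hU, (h _ ((mem_side_symm hT).1 h2)).1, mul_zero]

lemma apply_greenCol_side (hU : IsUnit M) {e : T.Dart} {w x : V} (hw : w ∉ side e)
    (hx : x ∈ side e) : M (greenCol M w) x = 0 := by
  rw [apply_greenCol hU, delta_of_ne]
  rintro rfl
  exact hw hx

/-- The combination `h` of the two columns vanishes at `e.fst` and has no source beyond `e`. Cut off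
along `e`, it is a multiple of the column at `e.fst`. If the factor is nonzero, that column vanishes
outside `side e`, and both products are zero. -/
lemma green_mul_green (hT : T.IsTree) (hlf : ∀ x : V, (T.neighborSet x).Finite)
    (hM : IsOperatorOn ρ M) (hU : IsUnit M) {e : T.Dart} {w w' : V} (hw : w ∉ side e)
    (hw' : w' ∉ side e) :
    green M w' e.fst * green M w e.snd = green M w e.fst * green M w' e.snd := by
  by_contra hne
  let h : L2 V := green M w' e.fst • greenCol M w - green M w e.fst • greenCol M w'
  have happ : ∀ x, h x = green M w' e.fst * green M w x - green M w e.fst * green M w' x := by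
    intro x
    rw [green_eq hM hU w x, green_eq hM hU w' x]
    rfl
  have hside : ∀ x ∈ side e, M h x = 0 := by
    intro x hx
    have : M h = green M w' e.fst • M (greenCol M w) - green M w e.fst • M (greenCol M w') := by
      simp only [h, map_sub, map_smul]
    rw [this, lp.coeFn_sub, Pi.sub_apply, lp.coeFn_smul, Pi.smul_apply, lp.coeFn_smul,
      Pi.smul_apply, apply_greenCol_side hU hw hx, apply_greenCol_side hU hw' hx]
    simp
  have hv : h e.snd ≠ 0 := by
    rw [happ]
    exact sub_ne_zero.2 hne
  have h1 := eq_smul_greenCol hU (hM.apply_cutoff hT hlf hside (by rw [happ]; ring))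
  have hc : coeff M e * h e.snd ≠ 0 := mul_ne_zero (hM.coeff_ne_zero e) hv
  have h2 : ∀ x ∉ side e, green M x e.fst = 0 := by
    intro x hx
    have h3 := congrArg (fun f : L2 V => f x) h1
    simp only [cutoff_of_notMem _ hx, lp.coeFn_smul, Pi.smul_apply, smul_eq_mul] at h3
    rw [green_comm hM hU, green_eq hM hU]
    exact (mul_eq_zero.1 h3.symm).resolve_left hc
  rw [h2 w hw, h2 w' hw', zero_mul, zero_mul] at hne
  exact hne rfl

end Green

/-! ### Ratios of the Green function -/

lemma genRatio_zero {b : ℂ} : genRatio b 0 = ∞ := by simp [genRatio]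

lemma genRatio_of_ne {b a : ℂ} (h : a ≠ 0) : genRatio b a = ((b / a : ℂ) : OnePoint ℂ) := by
  simp [genRatio, h]

@[simp] lemma finiteValue_coe (z : ℂ) : finiteValue (z : OnePoint ℂ) = z := rfl

@[simp] lemma finiteValue_infty : finiteValue ∞ = 0 := rfl

@[simp] lemma divRatio_coe (c z : ℂ) : divRatio c (z : OnePoint ℂ) = c / z := rfl

@[simp] lemma divRatio_infty (c : ℂ) : divRatio c ∞ = 0 := rfl

lemma coe_finiteValue {z : OnePoint ℂ} (h : z ≠ ∞) : (finiteValue z : OnePoint ℂ) = z := by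
  obtain ⟨c, rfl⟩ := OnePoint.ne_infty_iff_exists.1 h
  rfl

lemma finiteValue_eq_zero {z : OnePoint ℂ} (h : finiteValue z = 0) :
    z = ∞ ∨ z = ((0 : ℂ) : OnePoint ℂ) := by
  by_cases hz : z = ∞
  · exact Or.inl hz
  · right
    rw [← coe_finiteValue hz, h]

section Arises

variable {ρ : Γ →* (T ≃g T)} {M : L2 V →L[ℂ] L2 V} {r : T.Dart → OnePoint ℂ}

lemma exists_arisesFromGreen (hT : T.IsTree) (hlf : ∀ x : V, (T.neighborSet x).Finite)
    (hM : IsOperatorOn ρ M) (hU : IsUnit M) : ∃ r : T.Dart → OnePoint ℂ, ArisesFromGreen M r := by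
  choose w hw hne using exists_green_ne_zero hT hlf hM hU
  refine ⟨fun e => genRatio (green M (w e) e.snd) (green M (w e) e.fst), fun e =>
    ⟨⟨w e, (between_iff_not_mem_side hT).2 (hw e), hne e⟩, fun x hx hx0 => ?_⟩⟩
  have h := green_mul_green hT hlf hM hU ((between_iff_not_mem_side hT).1 hx) (hw e)
  beta_reduce
  by_cases h1 : green M (w e) e.fst = 0
  · have h2 := (hne e).resolve_left (not_not.2 h1)
    rw [h1, zero_mul, eq_comm, mul_eq_zero] at h
    rw [h1, h.resolve_right h2, genRatio_zero, genRatio_zero]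
  · by_cases h2 : green M x e.fst = 0
    · rw [h2, zero_mul, mul_eq_zero] at h
      exact absurd (h.resolve_left h1) (hx0.resolve_left (not_not.2 h2))
    · rw [genRatio_of_ne h1, genRatio_of_ne h2, OnePoint.coe_eq_coe, div_eq_div_iff h1 h2]
      linear_combination -h

namespace ArisesFromGreen

lemma exists_ne (hT : T.IsTree) (h : ArisesFromGreen M r) (e : T.Dart) :
    ∃ w ∉ side e, green M w e.fst ≠ 0 ∨ green M w e.snd ≠ 0 := by
  obtain ⟨⟨w, hw, hne⟩, -⟩ := h e
  exact ⟨w, (between_iff_not_mem_side hT).1 hw, hne⟩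

lemma eq_genRatio (hT : T.IsTree) (h : ArisesFromGreen M r) {e : T.Dart} {w : V}
    (hw : w ∉ side e) (hne : green M w e.fst ≠ 0 ∨ green M w e.snd ≠ 0) :
    r e = genRatio (green M w e.snd) (green M w e.fst) :=
  (h e).2 w ((between_iff_not_mem_side hT).2 hw) hne

lemma green_fst_eq_zero (hT : T.IsTree) (h : ArisesFromGreen M r) {e : T.Dart} (he : r e = ∞)
    {w : V} (hw : w ∉ side e) : green M w e.fst = 0 := by
  by_contra hne
  rw [h.eq_genRatio hT hw (Or.inl hne), genRatio_of_ne hne] at he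
  exact OnePoint.coe_ne_infty _ he

lemma green_snd_eq (hT : T.IsTree) (h : ArisesFromGreen M r) {e : T.Dart} (he : r e ≠ ∞)
    {w : V} (hw : w ∉ side e) : green M w e.snd = finiteValue (r e) * green M w e.fst := by
  by_cases h1 : green M w e.fst = 0
  · by_cases h2 : green M w e.snd = 0
    · rw [h1, h2, mul_zero]
    · rw [h.eq_genRatio hT hw (Or.inr h2), h1, genRatio_zero] at he
      exact absurd rfl he
  · rw [h.eq_genRatio hT hw (Or.inl h1), genRatio_of_ne h1, finiteValue_coe, div_mul_cancel₀ _ h1]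

lemma green_snd_eq_zero (hT : T.IsTree) (h : ArisesFromGreen M r) {e : T.Dart}
    (he : r e = ((0 : ℂ) : OnePoint ℂ)) {w : V} (hw : w ∉ side e) : green M w e.snd = 0 := by
  rw [h.green_snd_eq hT (by rw [he]; exact OnePoint.coe_ne_infty _) hw, he, finiteValue_coe,
    zero_mul]

lemma eq_infty_of (hT : T.IsTree) (h : ArisesFromGreen M r) {e : T.Dart} {w : V} (hw : w ∉ side e)
    (h0 : green M w e.fst = 0) (h1 : green M w e.snd ≠ 0) : r e = ∞ := by
  rw [h.eq_genRatio hT hw (Or.inr h1), h0, genRatio_zero]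

lemma eq_zero (hT : T.IsTree) (h : ArisesFromGreen M r) {e : T.Dart}
    (h0 : ∀ w ∉ side e, green M w e.snd = 0) : r e = ((0 : ℂ) : OnePoint ℂ) := by
  obtain ⟨w, hw, hne⟩ := h.exists_ne hT e
  rw [h.eq_genRatio hT hw hne, h0 w hw, genRatio_of_ne (hne.resolve_right (not_not.2 (h0 w hw))),
    zero_div]

lemma exists_snd_ne (hT : T.IsTree) (h : ArisesFromGreen M r) {e : T.Dart}
    (he : r e ≠ ((0 : ℂ) : OnePoint ℂ)) : ∃ w ∉ side e, green M w e.snd ≠ 0 := by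
  by_contra! h0
  exact he (h.eq_zero hT h0)

/-- Along an edge that follows `e`, the ratio of non-vanishing values is finite. -/
lemma ne_infty_of_follows (hT : T.IsTree) (h : ArisesFromGreen M r) {e f : T.Dart}
    (hf : Follows e f) {w : V} (hw : w ∉ side e) (hne : green M w e.snd ≠ 0) : r f ≠ ∞ := by
  intro hr
  refine hne ?_
  rw [hf.1]
  exact h.green_fst_eq_zero hT hr fun hw' => hw (hf.side_subset hT hw')

lemma sum_green (hT : T.IsTree) (hlf : ∀ x : V, (T.neighborSet x).Finite) (hM : IsOperatorOn ρ M)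
    (hU : IsUnit M) {e : T.Dart} {w : V} (hw : w ∉ side e) :
    0 = entry M e.snd e.snd * green M w e.snd + coeff M e.symm * green M w e.fst
      + ∑ f ∈ nextDarts hlf e, coeff M f * green M w f.snd := by
  have h := hM.apply_snd hT hlf (greenCol M w) e
  rw [apply_greenCol_side hU hw (snd_mem_side e)] at h
  simpa only [green_eq hM hU] using h

/-- Everything is read off `(M G(w,·))(v) = 0` at the head `v` of `e`. If `G(w,v) ≠ 0`, division
gives the recursion. If `G(w,v) = 0`, a nonzero value beyond `v` must balance `G(w,u)`, and the edge
leading to it has infinite ratio. -/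
lemma isRatioSystem (hT : T.IsTree) (hlf : ∀ x : V, (T.neighborSet x).Finite)
    (hM : IsOperatorOn ρ M) (hU : IsUnit M) (h : ArisesFromGreen M r) : IsRatioSystem M r where
  recursion e he := by
    obtain ⟨w, hw, hne⟩ := h.exists_snd_ne hT he
    have h1 := sum_green hT hlf hM hU hw
    rw [finsum_follows hlf]
    have h2 : ∑ f ∈ nextDarts hlf e, coeff M f * green M w f.snd =
        (∑ f ∈ nextDarts hlf e, coeff M f * finiteValue (r f)) * green M w e.snd := by
      rw [Finset.sum_mul]
      refine Finset.sum_congr rfl fun f hf => ?_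
      rw [mem_nextDarts] at hf
      rw [h.green_snd_eq hT (h.ne_infty_of_follows hT hf hw hne)
        (fun hw' => hw (hf.side_subset hT hw')), hf.1, mul_assoc]
    have h3 : coeff M e.symm * green M w e.fst =
        divRatio (coeff M e.symm) (r e) * green M w e.snd := by
      by_cases hr : r e = ∞
      · rw [hr, divRatio_infty, h.green_fst_eq_zero hT hr hw, mul_zero, zero_mul]
      · have hz : finiteValue (r e) ≠ 0 := fun hz => (finiteValue_eq_zero hz).elim hr he
        rw [h.green_snd_eq hT hr hw, ← coe_finiteValue hr, divRatio_coe, finiteValue_coe]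
        field_simp
    rw [h2, h3, ← add_mul, ← add_mul, eq_comm, mul_eq_zero] at h1
    exact (h1.resolve_right hne).symm
  zero e he := by
    by_contra! hno
    obtain ⟨w, hw, hne⟩ := h.exists_ne hT e
    have h0 := h.green_snd_eq_zero hT he hw
    have h1 := sum_green hT hlf hM hU hw
    rw [h0, mul_zero, zero_add, Finset.sum_eq_zero, add_zero, eq_comm, mul_eq_zero] at h1
    · exact hne.elim (fun h2 => h2 (h1.resolve_left (hM.coeff_ne_zero _))) (fun h2 => h2 h0)
    · intro f hf
      rw [mem_nextDarts] at hf
      by_contra h2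
      exact hno f hf (h.eq_infty_of hT (fun hw' => hw (hf.side_subset hT hw'))
        (by rw [← hf.1]; exact h0) (right_ne_zero_of_mul h2))
  infinite e f hf hef := by
    refine ⟨h.eq_zero hT fun w hw => ?_, fun h0 => ?_⟩
    · rw [hef.1]
      exact h.green_fst_eq_zero hT hf fun hw' => hw (hef.side_subset hT hw')
    -- If `r_f = ∞` and `r_{f⁻¹} = 0`, then `G(x, f.fst) = 0` for `x` on either side of `f`, so a
    -- whole column vanishes.
    · have h1 : greenCol M f.fst = 0 := by
        refine L2_ext fun x => ?_
        rw [← green_eq hM hU, green_comm hM hU]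
        by_cases hx : x ∈ side f
        · exact h.green_snd_eq_zero hT h0 (by rw [mem_side_symm hT]; exact not_not.2 hx)
        · exact h.green_fst_eq_zero hT hf hx
      have h2 := apply_greenCol hU f.fst
      rw [h1, map_zero] at h2
      have h3 := congrArg (fun k : L2 V => k f.fst) h2
      simp only [delta_self] at h3
      exact zero_ne_one h3

lemma isRatioSystemOn (hT : T.IsTree) (hlf : ∀ x : V, (T.neighborSet x).Finite)
    (hM : IsOperatorOn ρ M) (hU : IsUnit M) (h : ArisesFromGreen M r) :
    IsRatioSystemOn ρ M r where
  isRatioSystem := h.isRatioSystem hT hlf hM hU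
  invariant g e f h1 h2 := by
    obtain rfl : mapDart (ρ g) e = f := dart_ext h1 h2
    obtain ⟨w, hw, hne⟩ := h.exists_ne hT e
    have hw' : ρ g w ∉ side (mapDart (ρ g) e) := by rwa [mem_side_map]
    rw [h.eq_genRatio hT hw hne, h.eq_genRatio hT hw' (by
      simpa only [mapDart_fst, mapDart_snd, green_map hT hlf hM hU] using hne)]
    simp only [mapDart_fst, mapDart_snd, green_map hT hlf hM hU]

end ArisesFromGreen

end Arises

/-! ### Spectral radii of nonnegative matrices -/

section Spectral

variable {n : Type*} [Fintype n] [DecidableEq n]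

/-- Compare an eigenvector `x` with `N` at an index `a` where `‖x a‖ / N a` is maximal: the
eigenvalue has modulus at most `(N a - 1) / N a`. -/
lemma spectralRadius_lt_one_of_supersolution {R : Matrix n n ℝ} (hR : ∀ a b, 0 ≤ R a b)
    {N : n → ℝ} (hN : ∀ a, 0 ≤ N a) (h : ∀ a, 1 + ∑ b, R a b * N b ≤ N a) :
    spectralRadius ℂ (Matrix.of fun a b => (R a b : ℂ)) < 1 := by
  have hN1 : ∀ a, 1 ≤ N a := fun a =>
    le_trans (le_add_of_nonneg_right (Finset.sum_nonneg fun b _ => mul_nonneg (hR a b) (hN b)))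
      (h a)
  -- The summand `1` keeps `K` positive also for an empty index set.
  set K : ℝ := 1 + ∑ a, N a with hKdef
  have hK : ∀ a, N a ≤ K := fun a =>
    (Finset.single_le_sum (fun b _ => hN b) (Finset.mem_univ a)).trans (by linarith)
  have hK1 : 1 ≤ K := by
    have := Finset.sum_nonneg fun a (_ : a ∈ Finset.univ) => hN a
    linarith
  have hK0 : 0 < K := by linarith
  have key : ∀ z ∈ spectrum ℂ (Matrix.of fun a b => (R a b : ℂ)), ‖z‖ ≤ 1 - 1 / K := by
    intro z hz
    rw [spectrum.mem_iff, Matrix.isUnit_iff_isUnit_det, isUnit_iff_ne_zero, not_not,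
      ← Matrix.exists_mulVec_eq_zero_iff] at hz
    obtain ⟨x, hx0, hx⟩ := hz
    have heig : ∀ a, z * x a = ∑ b, (R a b : ℂ) * x b := by
      intro a
      have := congrFun hx a
      rw [Matrix.sub_mulVec, Pi.sub_apply, Pi.zero_apply, sub_eq_zero,
        Algebra.algebraMap_eq_smul_one, Matrix.smul_mulVec, Matrix.one_mulVec] at this
      exact this
    obtain ⟨c, hc⟩ : ∃ c, x c ≠ 0 := by
      by_contra! h0
      exact hx0 (funext h0)
    obtain ⟨a, -, ha⟩ := Finset.exists_max_image Finset.univ (fun b => ‖x b‖ / N b)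
      ⟨c, Finset.mem_univ c⟩
    have hNa := lt_of_lt_of_le one_pos (hN1 a)
    set t := ‖x a‖ / N a with ht
    have hxa : ‖x a‖ = t * N a := by rw [ht, div_mul_cancel₀ _ hNa.ne']
    have hxb : ∀ b, ‖x b‖ ≤ t * N b := fun b =>
      (div_le_iff₀ (lt_of_lt_of_le one_pos (hN1 b))).1 (ha b (Finset.mem_univ b))
    have htpos : 0 < t :=
      lt_of_lt_of_le (div_pos (norm_pos_iff.2 hc) (lt_of_lt_of_le one_pos (hN1 c)))
        (ha c (Finset.mem_univ c))
    have h1 : ‖z‖ * (t * N a) ≤ t * (N a - 1) := by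
      calc ‖z‖ * (t * N a) = ‖∑ b, (R a b : ℂ) * x b‖ := by rw [← heig, norm_mul, hxa]
        _ ≤ ∑ b, ‖(R a b : ℂ) * x b‖ := norm_sum_le _ _
        _ ≤ ∑ b, R a b * (t * N b) := by
            refine Finset.sum_le_sum fun b _ => ?_
            rw [norm_mul, Complex.norm_real, Real.norm_of_nonneg (hR a b)]
            exact mul_le_mul_of_nonneg_left (hxb b) (hR a b)
        _ = t * ∑ b, R a b * N b := by
            rw [Finset.mul_sum]
            exact Finset.sum_congr rfl fun b _ => by ring
        _ ≤ t * (N a - 1) := mul_le_mul_of_nonneg_left (by linarith [h a]) htpos.le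
    have h2 : ‖z‖ * N a ≤ N a - 1 := by
      refine le_of_mul_le_mul_left ?_ htpos
      linarith
    have h3 : ‖z‖ ≤ (N a - 1) / N a := (le_div_iff₀ hNa).2 h2
    refine h3.trans ?_
    rw [sub_div, div_self hNa.ne']
    have := one_div_le_one_div_of_le hNa (hK a)
    linarith
  refine lt_of_le_of_lt (b := ENNReal.ofReal (1 - 1 / K)) (iSup₂_le fun z hz => ?_) ?_
  · rw [← enorm_eq_nnnorm, ← ofReal_norm]
    exact ENNReal.ofReal_le_ofReal (key z hz)
  · rw [ENNReal.ofReal_lt_one]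
    have : 0 < 1 / K := by positivity
    linarith

/-- Gelfand's formula bounds `‖A ^ k‖` by `s ^ k` eventually, for some `s < 1`. -/
lemma tendsto_pow_mulVec_of_spectralRadius_lt_one {A : Matrix n n ℂ}
    (h : spectralRadius ℂ A < 1) (x : n → ℂ) (a : n) :
    Filter.Tendsto (fun k : ℕ => (A ^ k).mulVec x a) Filter.atTop (nhds 0) := by
  let _ : NormedRing (Matrix n n ℂ) := Matrix.linftyOpNormedRing
  let _ : NormedAlgebra ℂ (Matrix n n ℂ) := Matrix.linftyOpNormedAlgebra
  obtain ⟨s, hs, hs1⟩ := ENNReal.lt_iff_exists_nnreal_btwn.1 h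
  have h1 := (spectrum.pow_nnnorm_pow_one_div_tendsto_nhds_spectralRadius A).eventually
    (gt_mem_nhds hs)
  have h2 : ∀ᶠ k : ℕ in Filter.atTop, ‖(A ^ k).mulVec x‖ ≤ (s : ℝ) ^ k * ‖x‖ := by
    filter_upwards [h1, Filter.eventually_gt_atTop 0] with k hk hk0
    have h3 : (‖A ^ k‖₊ : ENNReal) ≤ (s : ENNReal) ^ k := by
      have := ENNReal.rpow_le_rpow hk.le (Nat.cast_nonneg k)
      rwa [← ENNReal.rpow_mul, one_div, inv_mul_cancel₀ (by positivity), ENNReal.rpow_one,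
        ENNReal.rpow_natCast] at this
    have h4 : ‖A ^ k‖ ≤ (s : ℝ) ^ k := by exact_mod_cast h3
    exact (Matrix.linfty_opNorm_mulVec _ _).trans (by gcongr)
  have hs1' : (s : ℝ) < 1 := by exact_mod_cast hs1
  refine squeeze_zero_norm' (a := fun k : ℕ => (s : ℝ) ^ k * ‖x‖) ?_ ?_
  · filter_upwards [h2] with k hk
    exact (norm_le_pi_norm _ a).trans hk
  · simpa using (tendsto_pow_atTop_nhds_zero_of_lt_one s.2 hs1').mul_const ‖x‖

/-- Since `1` is not in the spectrum, `x - A x = 1` has a complex solution. Its real part solves the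
same real system and is nonnegative as the limit of partial Neumann sums. -/
lemma exists_solution_of_spectralRadius_lt_one {R : Matrix n n ℝ} (hR : ∀ a b, 0 ≤ R a b)
    (h : spectralRadius ℂ (Matrix.of fun a b => (R a b : ℂ)) < 1) :
    ∃ N : n → ℝ, (∀ a, 1 ≤ N a) ∧ ∀ a, N a = 1 + ∑ b, R a b * N b := by
  set A : Matrix n n ℂ := Matrix.of fun a b => (R a b : ℂ) with hA
  have hunit : IsUnit (1 - A) := by
    have : (1 : ℂ) ∈ resolventSet ℂ A := spectrum.mem_resolventSet_of_spectralRadius_lt (by simpa)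
    simpa [spectrum.mem_resolventSet_iff] using this
  have hdet := (Matrix.isUnit_iff_isUnit_det _).1 hunit
  obtain ⟨x, hx⟩ : ∃ x : n → ℂ, x - A.mulVec x = 1 := by
    refine ⟨(1 - A)⁻¹.mulVec 1, ?_⟩
    have : (1 - A).mulVec ((1 - A)⁻¹.mulVec 1) = 1 := by
      rw [Matrix.mulVec_mulVec, Matrix.mul_nonsing_inv _ hdet, Matrix.one_mulVec]
    rwa [Matrix.sub_mulVec, Matrix.one_mulVec] at this
  have hre : ∀ (y : n → ℂ) (a : n), (A.mulVec y a).re = ∑ b, R a b * (y b).re := by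
    intro y a
    rw [Matrix.mulVec, dotProduct, Complex.re_sum]
    exact Finset.sum_congr rfl fun b _ => by simp [hA]
  -- The vector `x - A ^ k x` is the partial sum of `A ^ j 1` over `j < k`.
  have hpos : ∀ (k : ℕ) (a : n), 0 ≤ ((x - (A ^ k).mulVec x) a).re := by
    intro k
    induction k with
    | zero => intro a; simp
    | succ k ih =>
      intro a
      have : x - (A ^ (k + 1)).mulVec x = 1 + A.mulVec (x - (A ^ k).mulVec x) := by
        rw [Matrix.mulVec_sub, pow_succ', ← Matrix.mulVec_mulVec, ← hx]
        abel
      rw [this, Pi.add_apply, Complex.add_re, hre]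
      have h0 := Finset.sum_nonneg fun b (_ : b ∈ Finset.univ) => mul_nonneg (hR a b) (ih b)
      simpa using h0.trans (le_add_of_nonneg_left zero_le_one)
  have hlim : ∀ a, 0 ≤ (x a).re := by
    intro a
    have h1 := tendsto_pow_mulVec_of_spectralRadius_lt_one h x a
    have h2 := (Complex.continuous_re.tendsto _).comp (h1.const_sub (x a))
    rw [sub_zero] at h2
    exact ge_of_tendsto' h2 fun k => hpos k a
  have heq : ∀ a, (x a).re = 1 + ∑ b, R a b * (x b).re := by
    intro a
    rw [← hre]
    have := congrArg Complex.re (congrFun hx a)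
    simp only [Pi.sub_apply, Complex.sub_re, Pi.one_apply, Complex.one_re] at this
    linarith
  refine ⟨fun a => (x a).re, fun a => ?_, heq⟩
  beta_reduce
  rw [heq a]
  exact le_add_of_nonneg_right (Finset.sum_nonneg fun b _ => mul_nonneg (hR a b) (hlim b))

end Spectral

/-! ### The edge matrix and its quotient -/

section EdgeMatrix

variable {ρ : Γ →* (T ≃g T)} {M : L2 V →L[ℂ] L2 V} {r : T.Dart → OnePoint ℂ}

lemma IsRatioSystemOn.map (h : IsRatioSystemOn ρ M r) (g : Γ) (e : T.Dart) :
    r (mapDart (ρ g) e) = r e := h.invariant g _ _ rfl rfl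

lemma IsRatioSystemOn.apply_eq (h : IsRatioSystemOn ρ M r) {e f : T.Dart}
    (hef : EdgeOrbit.mk ρ e = EdgeOrbit.mk ρ f) : r e = r f := by
  obtain ⟨g, rfl⟩ := exists_mapDart_of_mk_eq hef
  exact (h.map g e).symm

lemma edgeMatrix_nonneg (M : L2 V →L[ℂ] L2 V) (r : T.Dart → OnePoint ℂ) (e f : T.Dart) :
    0 ≤ edgeMatrix M r e f := by
  unfold edgeMatrix
  split_ifs
  · exact finsum_nonneg fun d => finsum_nonneg fun _ => by positivity
  · positivity
  · exact le_rfl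

lemma edgeMatrix_of_follows {e f : T.Dart} (hf : r f ≠ ∞) (h : Follows e f) :
    edgeMatrix M r e f = ‖finiteValue (r f)‖ ^ 2 := by
  rw [edgeMatrix, if_neg hf, if_pos h]

/-- The ends of the intermediate edge are the head of `e` and the tail of `f`, so the defining sum
has a single term. -/
lemma edgeMatrix_of_infty {e d f : T.Dart} (hf : r f = ∞) (h1 : Follows e d) (h2 : Follows d f) :
    edgeMatrix M r e f = ‖coeff M d.symm / coeff M f‖ ^ 2 := by
  classical
  rw [edgeMatrix, if_pos hf, finsum_eq_single _ d, finsum_eq_if, if_pos ⟨h1, h2⟩]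
  intro d' hd'
  rw [finsum_eq_if, if_neg]
  rintro ⟨h3, h4⟩
  exact hd' (dart_ext (h3.1.symm.trans h1.1) (h4.1.trans h2.1.symm))

/-- The darts that follow `e` directly or after one intermediate edge. -/
noncomputable def nearDarts (hlf : ∀ x : V, (T.neighborSet x).Finite) (e : T.Dart) :
    Finset T.Dart :=
  let _ := Classical.decEq T.Dart
  nextDarts hlf e ∪ (nextDarts hlf e).biUnion (nextDarts hlf)

lemma mem_nearDarts {hlf : ∀ x : V, (T.neighborSet x).Finite} {e f : T.Dart} :
    f ∈ nearDarts hlf e ↔ Follows e f ∨ ∃ d, Follows e d ∧ Follows d f := by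
  classical
  simp [nearDarts, mem_nextDarts]

lemma mem_nearDarts_of_ne {hlf : ∀ x : V, (T.neighborSet x).Finite} {e f : T.Dart}
    (h : edgeMatrix M r e f ≠ 0) : f ∈ nearDarts hlf e := by
  classical
  rw [mem_nearDarts]
  unfold edgeMatrix at h
  split_ifs at h with h1 h2
  · by_contra! hno
    refine h (finsum_eq_zero_of_forall_eq_zero fun d => ?_)
    rw [finsum_eq_if, if_neg]
    rintro ⟨h3, h4⟩
    exact hno.2 d h3 h4
  · exact Or.inl h2
  · exact absurd rfl h

lemma edgeMatrix_map (hM : IsOperatorOn ρ M) (hr : IsRatioSystemOn ρ M r) (g : Γ)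
    (e f : T.Dart) :
    edgeMatrix M r (mapDart (ρ g) e) (mapDart (ρ g) f) = edgeMatrix M r e f := by
  by_cases hf : r f = ∞
  · rw [edgeMatrix, if_pos ((hr.map g f).trans hf), edgeMatrix, if_pos hf]
    refine (finsum_eq_of_bijective (dartEquiv (ρ g)) (dartEquiv (ρ g)).bijective fun d => ?_).symm
    simp only [dartEquiv_apply, follows_map, mapDart_symm, hM.coeff_map]
  · have hf' : r (mapDart (ρ g) f) ≠ ∞ := by rwa [hr.map]
    rw [edgeMatrix, if_neg hf', edgeMatrix, if_neg hf, hr.map]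
    by_cases h : Follows e f
    · rw [if_pos h, if_pos ((follows_map _).2 h)]
    · rw [if_neg h, if_neg (mt (follows_map _).1 h)]

/-- The matrix of `quotientMatrix`, with real entries. -/
noncomputable def realMatrix (ρ : Γ →* (T ≃g T)) (M : L2 V →L[ℂ] L2 V)
    (r : T.Dart → OnePoint ℂ) : Matrix (NonzeroOrbit ρ r) (NonzeroOrbit ρ r) ℝ :=
  Matrix.of fun a b => ∑ᶠ (f : T.Dart) (_ : EdgeOrbit.mk ρ f = b.1), edgeMatrix M r a.1.rep f

lemma realMatrix_nonneg (a b : NonzeroOrbit ρ r) : 0 ≤ realMatrix ρ M r a b :=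
  finsum_nonneg fun _ => finsum_nonneg fun _ => edgeMatrix_nonneg M r _ _

/-- The orbit of a dart on which `r` does not vanish. -/
def nonzeroOrbit (hr : IsRatioSystemOn ρ M r) (e : T.Dart)
    (he : r e ≠ ((0 : ℂ) : OnePoint ℂ)) : NonzeroOrbit ρ r :=
  ⟨EdgeOrbit.mk ρ e, by rwa [hr.apply_eq (mk_rep (EdgeOrbit.mk ρ e))]⟩

open Classical in
/-- The function on darts that is induced by a function on the nonzero orbits. -/
noncomputable def liftNonzero (hr : IsRatioSystemOn ρ M r) (φ : NonzeroOrbit ρ r → ℝ)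
    (e : T.Dart) : ℝ :=
  if he : r e ≠ ((0 : ℂ) : OnePoint ℂ) then φ (nonzeroOrbit hr e he) else 0

lemma liftNonzero_of_ne (hr : IsRatioSystemOn ρ M r) (φ : NonzeroOrbit ρ r → ℝ)
    {e : T.Dart} (he : r e ≠ ((0 : ℂ) : OnePoint ℂ)) :
    liftNonzero hr φ e = φ (nonzeroOrbit hr e he) := dif_pos he

/-- Invariance of the edge matrix lets any edge of the orbit replace the chosen representative. -/
lemma realMatrix_apply (hlf : ∀ x : V, (T.neighborSet x).Finite) (hM : IsOperatorOn ρ M)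
    (hr : IsRatioSystemOn ρ M r) [DecidableEq (EdgeOrbit ρ)] {e : T.Dart}
    (he : r e ≠ ((0 : ℂ) : OnePoint ℂ)) (b : NonzeroOrbit ρ r) :
    realMatrix ρ M r (nonzeroOrbit hr e he) b =
      ∑ f ∈ nearDarts hlf e with EdgeOrbit.mk ρ f = b.1, edgeMatrix M r e f := by
  obtain ⟨g, hg⟩ := exists_mapDart_of_mk_eq (mk_rep (EdgeOrbit.mk ρ e))
  have h1 : realMatrix ρ M r (nonzeroOrbit hr e he) b =
      ∑ᶠ (f : T.Dart) (_ : EdgeOrbit.mk ρ f = b.1), edgeMatrix M r e f := by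
    refine finsum_eq_of_bijective (dartEquiv (ρ g)) (dartEquiv (ρ g)).bijective fun f => ?_
    have h2 := edgeMatrix_map hM hr g (EdgeOrbit.mk ρ e).rep f
    rw [hg] at h2
    simp only [dartEquiv_apply, mk_mapDart, h2]
    rfl
  rw [h1]
  exact finsum_mem_eq_sum_of_inter_support_eq _ (by
    ext f
    simp only [Set.mem_inter_iff, Function.mem_support, Finset.coe_filter, Set.mem_ofPred_eq]
    constructor
    · rintro ⟨h2, h3⟩; exact ⟨⟨mem_nearDarts_of_ne h3, h2⟩, h3⟩
    · rintro ⟨⟨_, h2⟩, h3⟩; exact ⟨h2, h3⟩)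

/-- Regroup the row of the edge matrix by orbits; orbits on which `r` vanishes are absent on the
left and have lift zero on the right. -/
lemma sum_realMatrix [Fintype (NonzeroOrbit ρ r)] (hlf : ∀ x : V, (T.neighborSet x).Finite)
    (hM : IsOperatorOn ρ M) (hr : IsRatioSystemOn ρ M r) {e : T.Dart}
    (he : r e ≠ ((0 : ℂ) : OnePoint ℂ)) (φ : NonzeroOrbit ρ r → ℝ) :
    ∑ b, realMatrix ρ M r (nonzeroOrbit hr e he) b * φ b =
      ∑ f ∈ nearDarts hlf e, edgeMatrix M r e f * liftNonzero hr φ f := by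
  classical
  have h1 : ∀ b, realMatrix ρ M r (nonzeroOrbit hr e he) b * φ b =
      ∑ f ∈ nearDarts hlf e, if EdgeOrbit.mk ρ f = b.1 then edgeMatrix M r e f * φ b else 0 := by
    intro b
    rw [realMatrix_apply hlf hM hr he, Finset.sum_mul, Finset.sum_filter]
  rw [Finset.sum_congr rfl fun b _ => h1 b, Finset.sum_comm]
  refine Finset.sum_congr rfl fun f _ => ?_
  by_cases hf : r f ≠ ((0 : ℂ) : OnePoint ℂ)
  · rw [liftNonzero_of_ne hr φ hf, Finset.sum_eq_single (nonzeroOrbit hr f hf)]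
    · exact if_pos rfl
    · intro b _ hb
      exact if_neg fun h => hb (Subtype.ext h.symm)
    · exact fun h => absurd (Finset.mem_univ _) h
  · rw [liftNonzero, dif_neg hf, mul_zero]
    refine Finset.sum_eq_zero fun b _ => if_neg fun h => hf ?_
    have := b.2
    rwa [← hr.apply_eq (h.trans (mk_rep b.1).symm)] at this

end EdgeMatrix

/-! ### Ratio systems from Green functions have decay rate less than one -/

lemma hasSum_cutoff (s : Set V) (g : L2 V) :
    HasSum (fun x => ‖cutoff s g x‖ ^ 2) (‖cutoff s g‖ ^ 2) := by
  rw [norm_sq_eq_tsum]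
  exact (summable_norm_sq _).hasSum

lemma add_sum_norm_cutoff_le {ι : Type*} (S : Finset ι) (s : ι → Set V) (t : Set V) (g : L2 V)
    {v : V} (hv : v ∈ t) (hvs : ∀ i ∈ S, v ∉ s i) (hst : ∀ i ∈ S, s i ⊆ t)
    (hdis : ∀ i ∈ S, ∀ j ∈ S, ∀ x, x ∈ s i → x ∈ s j → i = j) :
    ‖g v‖ ^ 2 + ∑ i ∈ S, ‖cutoff (s i) g‖ ^ 2 ≤ ‖cutoff t g‖ ^ 2 := by
  classical
  have h1 : HasSum (fun x => if x = v then ‖g v‖ ^ 2 else 0) (‖g v‖ ^ 2) := hasSum_ite_eq v _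
  refine hasSum_le (fun x => ?_) (h1.add (hasSum_sum fun i _ => hasSum_cutoff (s i) g))
    (hasSum_cutoff t g)
  by_cases hx : x = v
  · subst hx
    rw [if_pos rfl, Finset.sum_eq_zero, add_zero, cutoff_of_mem g hv]
    intro i hi
    rw [cutoff_of_notMem g (hvs i hi)]
    simp
  · rw [if_neg hx, zero_add]
    by_cases hxs : ∃ i ∈ S, x ∈ s i
    · obtain ⟨i, hi, hxi⟩ := hxs
      rw [Finset.sum_eq_single_of_mem i hi, cutoff_of_mem g hxi, cutoff_of_mem g (hst i hi hxi)]
      intro j hj hne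
      rw [cutoff_of_notMem g fun hxj => hne (hdis j hj i hi x hxj hxi)]
      simp
    · push Not at hxs
      rw [Finset.sum_eq_zero]
      · positivity
      · intro i hi
        rw [cutoff_of_notMem g (hxs i hi)]
        simp

/-- At most one edge with infinite ratio starts at a vertex. -/
lemma IsRatioSystem.eq_of_infty {M : L2 V →L[ℂ] L2 V} {r : T.Dart → OnePoint ℂ}
    (hr : IsRatioSystem M r) {f f' : T.Dart} (h : f.fst = f'.fst) (hf : r f = ∞) (hf' : r f' = ∞) :
    f = f' := by
  by_contra hne
  have h1 : Follows f.symm f' := ⟨h, fun h' => hne (by rw [h', SimpleGraph.Dart.symm_symm])⟩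
  have h2 : Follows f'.symm f := ⟨h.symm, fun h' => hne (by rw [h', SimpleGraph.Dart.symm_symm])⟩
  exact (hr.infinite _ _ hf h2).2 (hr.infinite _ _ hf' h1).1

section

variable {ρ : Γ →* (T ≃g T)} {M : L2 V →L[ℂ] L2 V} {r : T.Dart → OnePoint ℂ}

/-- The mass of `G(w, ·)` beyond the edge `e`, relative to the value at the head of `e`. -/
noncomputable def greenMass (M : L2 V →L[ℂ] L2 V) (e : T.Dart) (w : V) : ℝ :=
  ‖cutoff (side e) (greenCol M w)‖ ^ 2 / ‖green M w e.snd‖ ^ 2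

lemma greenMass_nonneg (M : L2 V →L[ℂ] L2 V) (e : T.Dart) (w : V) : 0 ≤ greenMass M e w := by
  unfold greenMass
  positivity

namespace ArisesFromGreen

/-- The values of `G(w, ·)` at the heads of the edges after `e` that count in the edge matrix. -/
lemma norm_green_snd (hT : T.IsTree) (hlf : ∀ x : V, (T.neighborSet x).Finite)
    (hM : IsOperatorOn ρ M) (hU : IsUnit M) (h : ArisesFromGreen M r) {e f : T.Dart} {w : V}
    (hw : w ∉ side e) (hne : edgeMatrix M r e f ≠ 0) :
    ‖green M w f.snd‖ ^ 2 = edgeMatrix M r e f * ‖green M w e.snd‖ ^ 2 := by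
  have hr := h.isRatioSystem hT hlf hM hU
  by_cases hf : r f = ∞
  · have hmem := mem_nearDarts_of_ne (hlf := hlf) hne
    obtain ⟨d, h1, h2⟩ : ∃ d, Follows e d ∧ Follows d f := by
      refine (mem_nearDarts.1 hmem).elim (fun h1 => ?_) id
      exfalso
      refine hne ?_
      rw [edgeMatrix, if_pos hf]
      refine finsum_eq_zero_of_forall_eq_zero fun d => ?_
      classical
      rw [finsum_eq_if, if_neg]
      rintro ⟨h3, h4⟩
      exact h3.not_trans h4 h1
    have hwd : w ∉ side d := fun hw' => hw (h1.side_subset hT hw')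
    have hd := (hr.infinite d f hf h2).1
    have hd0 := h.green_snd_eq_zero hT hd hwd
    -- The column vanishes at the head of `d`, and `f` is the only edge with infinite ratio there.
    -- So the equation at this vertex balances just `m_{d⁻¹} G(w, d.fst)` against `m_f G(w, f.snd)`.
    have hsum := sum_green hT hlf hM hU hwd
    rw [hd0, mul_zero, zero_add, Finset.sum_eq_single_of_mem f (mem_nextDarts.2 h2), ← h1.1] at hsum
    · rw [edgeMatrix_of_infty hf h1 h2, ← mul_pow, ← norm_mul]
      congr 1
      rw [← norm_neg (_ * _)]
      congr 1
      have := hM.coeff_ne_zero f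
      field_simp
      linear_combination -hsum
    · intro f' hf' hne'
      rw [mem_nextDarts] at hf'
      rw [h.green_snd_eq hT (fun hr' => hne' (hr.eq_of_infty (hf'.1.symm.trans h2.1) hr' hf))
        (fun hw' => hwd (hf'.side_subset hT hw')), ← hf'.1, hd0, mul_zero, mul_zero]
  · by_cases h1 : Follows e f
    · rw [edgeMatrix_of_follows hf h1, h.green_snd_eq hT hf
        (fun hw' => hw (h1.side_subset hT hw')), ← h1.1, norm_mul, mul_pow]
    · rw [edgeMatrix, if_neg hf, if_neg h1] at hne
      exact absurd rfl hne

/-- The edges that contribute have disjoint sides inside `side e`, none containing the head of `e`.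
The masses beyond them add up, each rescaled by `R_{e,f}`, and the head contributes the `1`. -/
lemma one_add_sum_le_greenMass (hT : T.IsTree) (hlf : ∀ x : V, (T.neighborSet x).Finite)
    (hM : IsOperatorOn ρ M) (hU : IsUnit M) (h : ArisesFromGreen M r) {L : T.Dart → ℝ}
    (hL0 : ∀ f, r f = ((0 : ℂ) : OnePoint ℂ) → L f = 0)
    (hL : ∀ f, r f ≠ ((0 : ℂ) : OnePoint ℂ) → ∀ w ∉ side f, green M w f.snd ≠ 0 →
      L f ≤ greenMass M f w)
    {e : T.Dart} {w : V} (hw : w ∉ side e) (hne : green M w e.snd ≠ 0) :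
    1 + ∑ f ∈ nearDarts hlf e, edgeMatrix M r e f * L f ≤ greenMass M e w := by
  classical
  have hr := h.isRatioSystem hT hlf hM hU
  set S := (nearDarts hlf e).filter
    fun f => edgeMatrix M r e f ≠ 0 ∧ r f ≠ ((0 : ℂ) : OnePoint ℂ) with hS
  have hnear : ∀ f ∈ S, Follows e f ∧ r f ≠ ∞ ∨ r f = ∞ ∧ ∃ d, Follows e d ∧ Follows d f := by
    intro f hf
    obtain ⟨h1, h2, -⟩ := Finset.mem_filter.1 hf
    by_cases hfr : r f = ∞
    · refine Or.inr ⟨hfr, ?_⟩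
      by_contra hno
      refine h2 ?_
      rw [edgeMatrix, if_pos hfr]
      refine finsum_eq_zero_of_forall_eq_zero fun d => ?_
      rw [finsum_eq_if, if_neg]
      exact fun h3 => hno ⟨d, h3⟩
    · refine Or.inl ⟨?_, hfr⟩
      by_contra hno
      exact h2 (by rw [edgeMatrix, if_neg hfr, if_neg hno])
  have hsub : ∀ f ∈ S, side f ⊆ side e ∧ e.snd ∉ side f := by
    intro f hf
    rcases hnear f hf with ⟨h1, -⟩ | ⟨-, d, h1, h2⟩
    · exact ⟨h1.side_subset hT, h1.snd_not_mem_side⟩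
    · exact ⟨(h2.side_subset hT).trans (h1.side_subset hT),
        fun h3 => h1.snd_not_mem_side (h2.side_subset hT h3)⟩
  -- An edge reached directly and one reached by a jump have disjoint sides: otherwise the jump
  -- passes through `f`, which forces `r f = 0`.
  have hmix : ∀ f d f' x, f ∈ S → Follows e f → Follows e d → Follows d f' → r f' = ∞ →
      x ∈ side f → x ∈ side f' → False := by
    intro f d f' x hf h1 h2 h3 h4 hx hx'
    obtain rfl := eq_of_mem_side hT (h1.1.symm.trans h2.1) hx (h3.side_subset hT hx')
    exact (Finset.mem_filter.1 hf).2.2 (hr.infinite _ _ h4 h3).1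
  have hdis : ∀ f ∈ S, ∀ f' ∈ S, ∀ x, x ∈ side f → x ∈ side f' → f = f' := by
    intro f hf f' hf' x hx hx'
    rcases hnear f hf with ⟨h1, -⟩ | ⟨h1, d, h2, h3⟩ <;>
    rcases hnear f' hf' with ⟨h1', -⟩ | ⟨h1', d', h2', h3'⟩
    · exact eq_of_mem_side hT (h1.1.symm.trans h1'.1) hx hx'
    · exact (hmix f d' f' x hf h1 h2' h3' h1' hx hx').elim
    · exact (hmix f' d f x hf' h1' h2 h3 h1 hx' hx).elim
    · obtain rfl := eq_of_mem_side hT (h2.1.symm.trans h2'.1) (h3.side_subset hT hx)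
        (h3'.side_subset hT hx')
      exact eq_of_mem_side hT (h3.1.symm.trans h3'.1) hx hx'
  have hsum := add_sum_norm_cutoff_le S side (side e) (greenCol M w) (snd_mem_side e)
    (fun f hf => (hsub f hf).2) (fun f hf => (hsub f hf).1) hdis
  have hpos : 0 < ‖green M w e.snd‖ ^ 2 := by positivity
  rw [greenMass, le_div_iff₀ hpos, add_mul, one_mul, Finset.sum_mul]
  rw [← green_eq hM hU] at hsum
  refine le_trans (add_le_add_right ?_ _) hsum
  rw [← Finset.sum_filter_of_ne (p := fun f => edgeMatrix M r e f ≠ 0 ∧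
    r f ≠ ((0 : ℂ) : OnePoint ℂ)), ← hS]
  · refine Finset.sum_le_sum fun f hf => ?_
    obtain ⟨-, h2, h3⟩ := Finset.mem_filter.1 hf
    have hval := h.norm_green_snd hT hlf hM hU hw h2
    have hf0 : green M w f.snd ≠ 0 := by
      intro h0
      rw [h0, norm_zero, zero_pow two_ne_zero, eq_comm, mul_eq_zero] at hval
      exact hval.elim h2 hpos.ne'
    have hle := hL f h3 w (fun hw' => hw ((hsub f hf).1 hw')) hf0
    rw [greenMass, le_div_iff₀ (by positivity), hval] at hle
    linarith
  · intro f hf hne'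
    refine ⟨fun h0 => hne' (by rw [h0, zero_mul, zero_mul]), fun h0 => hne' ?_⟩
    rw [hL0 f h0, mul_zero, zero_mul]

lemma decayRate_lt_one [Finite (EdgeOrbit ρ)] (hT : T.IsTree)
    (hlf : ∀ x : V, (T.neighborSet x).Finite) (hM : IsOperatorOn ρ M) (hU : IsUnit M)
    (h : ArisesFromGreen M r) : decayRate ρ M r < 1 := by
  have hr := h.isRatioSystemOn hT hlf hM hU
  -- The infimum over all edges of the orbit and all admissible `w` makes it unnecessary to know how
  -- the mass depends on them.
  let S : NonzeroOrbit ρ r → Set ℝ := fun a => {t | ∃ (e : T.Dart) (w : V),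
    EdgeOrbit.mk ρ e = a.1 ∧ w ∉ side e ∧ green M w e.snd ≠ 0 ∧ greenMass M e w = t}
  have hbdd : ∀ a, BddBelow (S a) := by
    refine fun a => ⟨0, ?_⟩
    rintro _ ⟨e, w, -, -, -, rfl⟩
    exact greenMass_nonneg M e w
  have hnonempty : ∀ a, (S a).Nonempty := by
    intro a
    obtain ⟨w, hw, hne⟩ := h.exists_snd_ne hT a.2
    exact ⟨_, _, w, mk_rep a.1, hw, hne, rfl⟩
  classical
  let _ := Fintype.ofFinite (NonzeroOrbit ρ r)
  unfold decayRate
  refine spectralRadius_lt_one_of_supersolution (R := realMatrix ρ M r) realMatrix_nonneg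
    (N := fun a => sInf (S a)) (fun a => ?_) (fun a => ?_)
  · exact le_csInf (hnonempty a) (by rintro _ ⟨e, w, -, -, -, rfl⟩; exact greenMass_nonneg M e w)
  · refine le_csInf (hnonempty a) ?_
    rintro _ ⟨e, w, hea, hw, hne, rfl⟩
    have he : r e ≠ ((0 : ℂ) : OnePoint ℂ) := by
      rw [hr.apply_eq (hea.trans (mk_rep a.1).symm)]
      exact a.2
    obtain rfl : nonzeroOrbit hr e he = a := Subtype.ext hea
    rw [sum_realMatrix hlf hM hr he]
    refine h.one_add_sum_le_greenMass hT hlf hM hU (fun f hf => ?_) (fun f hf w' hw' hne' => ?_)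
      hw hne
    · exact dif_neg (not_not.2 hf)
    · rw [liftNonzero_of_ne hr _ hf]
      exact csInf_le (hbdd _) ⟨f, w', rfl, hw', hne', rfl⟩

end ArisesFromGreen

end

/-! ### Invertibility of some weighted composition operators -/

lemma sum_norm_sq_le_of_injective {t : V → ℂ} {q : V → V} (hq : Function.Injective q) {K : ℝ}
    (ht : ∀ y, ‖t y‖ ≤ K) (v : V) (F : Finset V) (hF : ∀ y ∈ F, q y = v) :
    ∑ y ∈ F, ‖t y‖ ^ 2 ≤ K ^ 2 := by
  have hcard : F.card ≤ 1 :=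
    Finset.card_le_one.2 fun a ha b hb => hq ((hF a ha).trans (hF b hb).symm)
  have : Nonempty V := ⟨v⟩
  obtain ⟨a, ha⟩ := Finset.card_le_one_iff_subset_singleton.1 hcard
  calc ∑ y ∈ F, ‖t y‖ ^ 2 ≤ ∑ y ∈ {a}, ‖t y‖ ^ 2 :=
        Finset.sum_le_sum_of_subset_of_nonneg ha fun _ _ _ => by positivity
    _ = ‖t a‖ ^ 2 := Finset.sum_singleton _ _
    _ ≤ K ^ 2 := by gcongr; exact ht a

lemma exists_weightedComp_of_injective [Nonempty V] (t : V → ℂ) {q : V → V}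
    (hq : Function.Injective q) {K : ℝ} (ht : ∀ y, ‖t y‖ ≤ K) :
    ∃ A : L2 V →L[ℂ] L2 V, ∀ f y, A f y = t y * f (q y) := by
  obtain ⟨A, hA, -⟩ := exists_weightedComp t q (sq_nonneg K) (sum_norm_sq_le_of_injective hq ht)
  exact ⟨A, hA⟩

/-- Conjugation by multiplication with `√N` turns `A` into an operator of norm at most `√θ < 1`; as
`N` lies between `1` and `K`, the conjugation is bounded with bounded inverse. -/
lemma isUnit_one_sub_of_weights [Nonempty V] {t : V → ℂ} {q : V → V} {N : V → ℝ} {K θ : ℝ}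
    (hN1 : ∀ v, 1 ≤ N v) (hNK : ∀ v, N v ≤ K) (hθ0 : 0 ≤ θ) (hθ1 : θ < 1)
    (h : ∀ (v : V) (F : Finset V), (∀ y ∈ F, q y = v) → ∑ y ∈ F, ‖t y‖ ^ 2 * N y ≤ θ * N v)
    {A : L2 V →L[ℂ] L2 V} (hA : ∀ f y, A f y = t y * f (q y)) : IsUnit (1 - A) := by
  have hN0 : ∀ v, 0 < N v := fun v => one_pos.trans_le (hN1 v)
  have hs0 : ∀ v, 0 < √(N v) := fun v => Real.sqrt_pos.2 (hN0 v)
  have hsc : ∀ v, ((√(N v) : ℝ) : ℂ) ≠ 0 := fun v => Complex.ofReal_ne_zero.2 (hs0 v).ne'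
  obtain ⟨B, hB, hBn⟩ := exists_weightedComp (fun y => √(N y) * t y / √(N (q y)) : V → ℂ) q hθ0 (by
    intro v F hF
    have h1 := h v F hF
    calc ∑ y ∈ F, ‖(√(N y) * t y / √(N (q y)) : ℂ)‖ ^ 2
        = (∑ y ∈ F, ‖t y‖ ^ 2 * N y) / N v := by
          rw [Finset.sum_div]
          refine Finset.sum_congr rfl fun y hy => ?_
          rw [hF y hy, norm_div, norm_mul, Complex.norm_real, Complex.norm_real, div_pow, mul_pow,
            Real.norm_of_nonneg (Real.sqrt_nonneg _), Real.norm_of_nonneg (Real.sqrt_nonneg _),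
            Real.sq_sqrt (hN0 y).le, Real.sq_sqrt (hN0 v).le, mul_comm (N y)]
      _ ≤ θ := (div_le_iff₀ (hN0 v)).2 h1)
  obtain ⟨W, hW⟩ := exists_weightedComp_of_injective (fun y => (√(N y) : ℂ))
    Function.injective_id (K := √K) (fun y => by
      rw [Complex.norm_real, Real.norm_of_nonneg (Real.sqrt_nonneg _)]
      exact Real.sqrt_le_sqrt (hNK y))
  obtain ⟨W', hW'⟩ := exists_weightedComp_of_injective (fun y => (√(N y) : ℂ)⁻¹)
    Function.injective_id (K := 1) (fun y => by
      rw [norm_inv, Complex.norm_real, Real.norm_of_nonneg (Real.sqrt_nonneg _)]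
      exact inv_le_one_of_one_le₀ (Real.one_le_sqrt.2 (hN1 y)))
  have hWW' : W * W' = 1 := by
    refine ContinuousLinearMap.ext fun f => L2_ext fun y => ?_
    change W (W' f) y = f y
    rw [hW, hW', id, id, ← mul_assoc, mul_inv_cancel₀ (hsc y), one_mul]
  have hW'W : W' * W = 1 := by
    refine ContinuousLinearMap.ext fun f => L2_ext fun y => ?_
    change W' (W f) y = f y
    rw [hW', hW, id, id, ← mul_assoc, inv_mul_cancel₀ (hsc y), one_mul]
  have hWA : W * A = B * W := by
    refine ContinuousLinearMap.ext fun f => L2_ext fun y => ?_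
    change W (A f) y = B (W f) y
    rw [hW, hA, hB, hW, id, id]
    have := hsc (q y)
    field_simp
  have hB1 : ‖B‖ < 1 := by
    refine hBn.trans_lt ?_
    rw [Real.sqrt_lt' one_pos, one_pow]
    exact hθ1
  have heq : 1 - A = W' * (1 - B) * W := by
    rw [mul_assoc, sub_mul, one_mul, ← hWA, mul_sub, hW'W, ← mul_assoc, hW'W, one_mul]
  rw [heq]
  have hunitW : IsUnit W := ⟨⟨W, W', hWW', hW'W⟩, rfl⟩
  have hunitW' : IsUnit W' := ⟨⟨W', W, hW'W, hWW'⟩, rfl⟩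
  exact (hunitW'.mul (isUnit_one_sub_of_norm_lt_one hB1)).mul hunitW

/-- The weights only matter at the vertices where `t` does not vanish. -/
lemma isUnit_one_sub_of_weights' [Nonempty V] {t : V → ℂ} {q : V → V} {N : V → ℝ} {K θ C : ℝ}
    (hN1 : ∀ v, 1 ≤ N v) (hNK : ∀ v, N v ≤ K) (hθ0 : 0 < θ) (hθ1 : θ < 1) (hC : 0 ≤ C)
    (hb : ∀ (v : V) (F : Finset V), (∀ y ∈ F, q y = v) → ∑ y ∈ F, ‖t y‖ ^ 2 * N y ≤ C)
    (h : ∀ (v : V) (F : Finset V), t v ≠ 0 → (∀ y ∈ F, q y = v) →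
      ∑ y ∈ F, ‖t y‖ ^ 2 * N y ≤ θ * N v)
    {A : L2 V →L[ℂ] L2 V} (hA : ∀ f y, A f y = t y * f (q y)) : IsUnit (1 - A) := by
  classical
  have hCθ : 0 ≤ C / θ := by positivity
  -- Where `t v = 0`, the weight at `v` drops out of every fibre sum, so it can be raised until `θ`
  -- times it exceeds `C`.
  refine isUnit_one_sub_of_weights (N := fun v => if t v = 0 then C / θ + 1 else N v)
    (K := max K (C / θ + 1)) (fun v => ?_) (fun v => ?_) hθ0.le hθ1 (fun v F hF => ?_) hA
  · split_ifs
    · linarith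
    · exact hN1 v
  · split_ifs
    · exact le_max_right _ _
    · exact (hNK v).trans (le_max_left _ _)
  · have h1 : ∑ y ∈ F, ‖t y‖ ^ 2 * (if t y = 0 then C / θ + 1 else N y) =
        ∑ y ∈ F, ‖t y‖ ^ 2 * N y := by
      refine Finset.sum_congr rfl fun y _ => ?_
      split_ifs with h0
      · simp [h0]
      · rfl
    rw [h1]
    split_ifs with h0
    · refine (hb v F hF).trans ?_
      rw [mul_add, mul_div_cancel₀ _ hθ0.ne']
      linarith
    · exact h v F h0 hF

/-- Conjugated weights in `A` make its adjoint the transpose of the operator with weights `t`, as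
the symmetric factorization requires. -/
lemma adjoint_weightedComp_delta {t : V → ℂ} {q : V → V} {A : L2 V →L[ℂ] L2 V}
    (hA : ∀ f y, A f y = star (t y) * f (q y)) (y : V) :
    ContinuousLinearMap.adjoint A (delta y) = t y • delta (q y) := by
  refine L2_ext fun x => ?_
  rw [← inner_delta, ContinuousLinearMap.adjoint_inner_right, ← inner_conj_symm, inner_delta, hA,
    lp.coeFn_smul, Pi.smul_apply, smul_eq_mul, map_mul]
  have : (starRingEnd ℂ) (delta x (q y)) = delta (q y) x := by
    by_cases h : q y = x
    · rw [h, delta_self, map_one]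
    · rw [delta_of_ne h, delta_of_ne (Ne.symm h), map_zero]
  rw [this]
  simp

lemma isUnit_one_sub_adjoint {A : L2 V →L[ℂ] L2 V} (h : IsUnit (1 - A)) :
    IsUnit (1 - ContinuousLinearMap.adjoint A) := by
  have := h.star
  rwa [star_sub, star_one, ContinuousLinearMap.star_eq_adjoint] at this

/-- A diagonal operator plus an operator that is supported on the pairs `{v, σ v}`. -/
lemma exists_pairOperator [Nonempty V] {d c : V → ℂ} {σ : V → V} (hσ : Function.Involutive σ)
    {K : ℝ} (hd : ∀ v, ‖d v‖ ≤ K) (hc : ∀ v, ‖c v‖ ≤ K) :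
    ∃ D : L2 V →L[ℂ] L2 V, ∀ f v, D f v = d v * f v + c v * f (σ v) := by
  obtain ⟨A, hA⟩ := exists_weightedComp_of_injective d Function.injective_id hd
  obtain ⟨B, hB⟩ := exists_weightedComp_of_injective c hσ.injective hc
  refine ⟨A + B, fun f v => ?_⟩
  rw [add_apply, lp.coeFn_add, Pi.add_apply, hA, hB, id]

/-- Cramer's rule on each pair `{v, σ v}`. The same formula also serves fixed points of `σ`, with
determinant `d² - c²`. -/
lemma isUnit_pairOperator [Nonempty V] {d c : V → ℂ} {σ : V → V} (hσ : Function.Involutive σ)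
    {K K' : ℝ} (hd : ∀ v, ‖d v‖ ≤ K) (hc : ∀ v, ‖c v‖ ≤ K)
    (h0 : ∀ v, d v * d (σ v) - c v * c (σ v) ≠ 0)
    (hK' : ∀ v, ‖(d v * d (σ v) - c v * c (σ v))⁻¹‖ ≤ K')
    {D : L2 V →L[ℂ] L2 V} (hD : ∀ f v, D f v = d v * f v + c v * f (σ v)) : IsUnit D := by
  have hK0 : 0 ≤ K := (norm_nonneg _).trans (hd (Classical.arbitrary V))
  obtain ⟨E, hE⟩ := exists_pairOperator
    (d := fun v => d (σ v) * (d v * d (σ v) - c v * c (σ v))⁻¹)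
    (c := fun v => -(c v * (d v * d (σ v) - c v * c (σ v))⁻¹)) hσ (K := K * K') (fun v => by
      rw [norm_mul]
      exact mul_le_mul (hd _) (hK' v) (norm_nonneg _) hK0) (fun v => by
      rw [norm_neg, norm_mul]
      exact mul_le_mul (hc _) (hK' v) (norm_nonneg _) hK0)
  have key : ∀ v, d (σ v) * d v - c (σ v) * c v = d v * d (σ v) - c v * c (σ v) := fun v => by ring
  refine ⟨⟨D, E, ?_, ?_⟩, rfl⟩ <;> refine ContinuousLinearMap.ext fun f => L2_ext fun v => ?_
  · change D (E f) v = f v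
    rw [hD, hE, hE, hσ v, key v]
    linear_combination f v * mul_inv_cancel₀ (h0 v)
  · change E (D f) v = f v
    rw [hE, hD, hD, hσ v]
    linear_combination f v * mul_inv_cancel₀ (h0 v)

/-! ### Rooted trees -/

/-- `E y` is the edge that enters `y` on the way from the root `o`, for every `y ≠ o`. -/
structure IsRooting (o : V) (E : V → T.Dart) : Prop where
  snd : ∀ y, y ≠ o → (E y).snd = y
  away : ∀ y, y ≠ o → o ∉ side (E y)

lemma exists_isRooting [Infinite V] (hT : T.IsTree) (o : V) :
    ∃ E : V → T.Dart, IsRooting o E := by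
  have h : ∀ y, ∃ e : T.Dart, y ≠ o → e.snd = y ∧ o ∉ side e := by
    intro y
    by_cases hy : y = o
    -- At the root the value is arbitrary; any edge will do.
    · obtain ⟨z, hz⟩ := exists_ne o
      obtain ⟨p, hp, -⟩ := exists_adj_dist_lt hT hz
      exact ⟨⟨(p, z), hp⟩, fun h => absurd hy h⟩
    · obtain ⟨p, hp, hd⟩ := exists_adj_dist_lt hT hy
      exact ⟨⟨(p, y), hp⟩, fun _ => ⟨rfl, (not_mem_side hT).2 hd⟩⟩
  choose E hE using h
  exact ⟨E, fun y hy => (hE y hy).1, fun y hy => (hE y hy).2⟩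

lemma snd_ne_of_away {o : V} {f : T.Dart} (h : o ∉ side f) : f.snd ≠ o :=
  fun h' => h (h' ▸ snd_mem_side f)

lemma away_of_fst_eq {o : V} {f : T.Dart} (h : f.fst = o) : o ∉ side f :=
  h ▸ fst_not_mem_side f

lemma Follows.away (hT : T.IsTree) {o : V} {e f : T.Dart} (h : Follows e f) (he : o ∉ side e) :
    o ∉ side f := fun hf => he (h.side_subset hT hf)

lemma eq_of_away_of_snd_eq (hT : T.IsTree) {o : V} {e f : T.Dart} (he : o ∉ side e)
    (hf : o ∉ side f) (h : e.snd = f.snd) : e = f := by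
  rw [not_mem_side hT] at he hf
  exact dart_ext (eq_of_adj_dist_lt hT e.adj (by rw [h]; exact f.adj) he (by rw [h]; exact hf)) h

lemma follows_of_away (hT : T.IsTree) {o : V} {e f : T.Dart} (he : o ∉ side e) (hf : o ∉ side f)
    (h : e.snd = f.fst) : Follows e f :=
  ⟨h, fun h' => by rw [h', mem_side_symm hT, not_not] at hf; exact he hf⟩

namespace IsRooting

variable {o : V} {E : V → T.Dart}

lemma apply_snd (hT : T.IsTree) (hE : IsRooting o E) {f : T.Dart} (hf : o ∉ side f) :
    E f.snd = f :=
  eq_of_away_of_snd_eq hT (hE.away _ (snd_ne_of_away hf)) hf (hE.snd _ (snd_ne_of_away hf))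

lemma follows (hT : T.IsTree) (hE : IsRooting o E) {f : T.Dart} (hf : o ∉ side f)
    (h : f.fst ≠ o) : Follows (E f.fst) f :=
  follows_of_away hT (hE.away _ h) hf (hE.snd _ h)

end IsRooting

lemma finite_children (hlf : ∀ x : V, (T.neighborSet x).Finite) (o v : V) :
    {f : T.Dart | f.fst = v ∧ o ∉ side f}.Finite := by
  refine Set.Finite.of_finite_image (f := fun f : T.Dart => f.snd) ((hlf v).subset ?_) ?_
  · rintro _ ⟨f, ⟨rfl, -⟩, rfl⟩
    exact f.adj
  · intro f hf f' hf' h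
    exact dart_ext (hf.1.trans hf'.1.symm) h

/-- The edges that start at `v` and point away from the root `o`. -/
noncomputable def children (hlf : ∀ x : V, (T.neighborSet x).Finite) (o v : V) : Finset T.Dart :=
  (finite_children hlf o v).toFinset

lemma mem_children {hlf : ∀ x : V, (T.neighborSet x).Finite} {o v : V} {f : T.Dart} :
    f ∈ children hlf o v ↔ f.fst = v ∧ o ∉ side f := by
  simp [children]

lemma children_eq (hT : T.IsTree) {hlf : ∀ x : V, (T.neighborSet x).Finite} {o : V} {e : T.Dart}
    (he : o ∉ side e) : children hlf o e.snd = nextDarts hlf e := by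
  ext f
  rw [mem_children, mem_nextDarts]
  exact ⟨fun h => follows_of_away hT he h.2 h.1.symm, fun h => ⟨h.1.symm, h.away hT he⟩⟩

lemma sum_neighbors_root {F : Type*} [AddCommMonoid F]
    (hlf : ∀ x : V, (T.neighborSet x).Finite) (o : V) (φ : V → F) :
    ∑ y ∈ (hlf o).toFinset, φ y = ∑ f ∈ children hlf o o, φ f.snd := by
  classical
  have h : (hlf o).toFinset = (children hlf o o).image fun f => f.snd := by
    ext y
    simp only [Set.Finite.mem_toFinset, SimpleGraph.mem_neighborSet, Finset.mem_image, mem_children]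
    constructor
    · intro hy
      exact ⟨⟨(o, y), hy⟩, ⟨rfl, away_of_fst_eq rfl⟩, rfl⟩
    · rintro ⟨f, ⟨hf, -⟩, rfl⟩
      rw [← hf]
      exact f.adj
  rw [h, Finset.sum_image]
  intro f hf f' hf' h
  rw [Finset.mem_coe, mem_children] at hf hf'
  exact dart_ext (hf.1.trans hf'.1.symm) h

/-! ### The coefficients of the triangular factorization -/

section Factorization

variable {ρ : Γ →* (T ≃g T)} {M : L2 V →L[ℂ] L2 V} {r : T.Dart → OnePoint ℂ} {o : V}
  {E : V → T.Dart}

open Classical in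
/-- The weight of the step from `stepBack y` to `y`. -/
noncomputable def stepWeight (M : L2 V →L[ℂ] L2 V) (r : T.Dart → OnePoint ℂ) (o : V)
    (E : V → T.Dart) (y : V) : ℂ :=
  if y = o then 0
  else if r (E y) = ∞ then
    if (E y).fst = o then 0 else -(coeff M (E (E y).fst).symm / coeff M (E y))
  else finiteValue (r (E y))

open Classical in
/-- The parent of `y`, or the grandparent if the ratio of the edge to `y` is infinite. -/
noncomputable def stepBack (r : T.Dart → OnePoint ℂ) (o : V) (E : V → T.Dart) (y : V) : V :=
  if y = o then o
  else if r (E y) = ∞ then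
    if (E y).fst = o then o else (E (E y).fst).fst
  else (E y).fst

lemma stepWeight_root : stepWeight M r o E o = 0 := if_pos rfl

lemma stepWeight_finite (hT : T.IsTree) (hE : IsRooting o E) {f : T.Dart} (hf : o ∉ side f)
    (hr : r f ≠ ∞) : stepWeight M r o E f.snd = finiteValue (r f) := by
  rw [stepWeight, if_neg (snd_ne_of_away hf), hE.apply_snd hT hf, if_neg hr]

lemma stepBack_finite (hT : T.IsTree) (hE : IsRooting o E) {f : T.Dart} (hf : o ∉ side f)
    (hr : r f ≠ ∞) : stepBack r o E f.snd = f.fst := by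
  rw [stepBack, if_neg (snd_ne_of_away hf), hE.apply_snd hT hf, if_neg hr]

lemma stepWeight_infty (hT : T.IsTree) (hE : IsRooting o E) {e f : T.Dart} (he : o ∉ side e)
    (h : Follows e f) (hr : r f = ∞) :
    stepWeight M r o E f.snd = -(coeff M e.symm / coeff M f) := by
  have hf := h.away hT he
  rw [stepWeight, if_neg (snd_ne_of_away hf), hE.apply_snd hT hf, if_pos hr, ← h.1,
    if_neg (snd_ne_of_away he), hE.apply_snd hT he]

lemma stepBack_infty (hT : T.IsTree) (hE : IsRooting o E) {e f : T.Dart} (he : o ∉ side e)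
    (h : Follows e f) (hr : r f = ∞) : stepBack r o E f.snd = e.fst := by
  have hf := h.away hT he
  rw [stepBack, if_neg (snd_ne_of_away hf), hE.apply_snd hT hf, if_pos hr, ← h.1,
    if_neg (snd_ne_of_away he), hE.apply_snd hT he]

lemma stepWeight_infty_root (hT : T.IsTree) (hE : IsRooting o E) {f : T.Dart} (hf : f.fst = o)
    (hr : r f = ∞) : stepWeight M r o E f.snd = 0 := by
  have hf' := away_of_fst_eq hf
  rw [stepWeight, if_neg (snd_ne_of_away hf'), hE.apply_snd hT hf', if_pos hr, if_pos hf]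

/-- A vertex is the root, or it is entered by an edge with finite ratio, or by an edge with
infinite ratio that starts at the root or follows another edge. -/
lemma IsRooting.cases (hT : T.IsTree) (hE : IsRooting o E) (r : T.Dart → OnePoint ℂ) (y : V) :
    y = o ∨ (∃ f : T.Dart, o ∉ side f ∧ r f ≠ ∞ ∧ f.snd = y) ∨
      (∃ f : T.Dart, f.fst = o ∧ r f = ∞ ∧ f.snd = y) ∨
      ∃ e f : T.Dart, o ∉ side e ∧ Follows e f ∧ r f = ∞ ∧ f.snd = y := by
  by_cases hy : y = o
  · exact Or.inl hy
  have h1 := hE.snd y hy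
  have h2 := hE.away y hy
  by_cases hr : r (E y) = ∞
  · by_cases h3 : (E y).fst = o
    · exact Or.inr (Or.inr (Or.inl ⟨_, h3, hr, h1⟩))
    · exact Or.inr (Or.inr (Or.inr ⟨_, _, hE.away _ h3, hE.follows hT h2 h3, hr, h1⟩))
  · exact Or.inr (Or.inl ⟨_, h2, hr, h1⟩)

open Classical in
/-- The involution that exchanges the ends of the edges with infinite ratio that point away from
the root. -/
noncomputable def partner (r : T.Dart → OnePoint ℂ) (o v : V) : V :=
  if h : ∃ f : T.Dart, o ∉ side f ∧ r f = ∞ ∧ f.snd = v then h.choose.fst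
  else if h : ∃ f : T.Dart, o ∉ side f ∧ r f = ∞ ∧ f.fst = v then h.choose.snd
  else v

lemma partner_snd (hT : T.IsTree) {f : T.Dart} (hf : o ∉ side f) (hr : r f = ∞) :
    partner r o f.snd = f.fst := by
  have h : ∃ f' : T.Dart, o ∉ side f' ∧ r f' = ∞ ∧ f'.snd = f.snd := ⟨f, hf, hr, rfl⟩
  rw [partner, dif_pos h, eq_of_away_of_snd_eq hT h.choose_spec.1 hf h.choose_spec.2.2]

lemma partner_fst (hT : T.IsTree) (hR : IsRatioSystem M r) {f : T.Dart} (hf : o ∉ side f)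
    (hr : r f = ∞) : partner r o f.fst = f.snd := by
  have h : ∃ f' : T.Dart, o ∉ side f' ∧ r f' = ∞ ∧ f'.fst = f.fst := ⟨f, hf, hr, rfl⟩
  rw [partner, dif_neg, dif_pos h, hR.eq_of_infty h.choose_spec.2.2 h.choose_spec.2.1 hr]
  -- The tail of an edge with infinite ratio is not the head of another such edge pointing away from
  -- `o`, because the preceding edge has ratio zero.
  rintro ⟨f', h1, h2, h3⟩
  have := (hR.infinite f' f hr (follows_of_away hT h1 hf h3)).1
  rw [h2] at this
  exact OnePoint.infty_ne_coe _ this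

lemma partner_eq_self {v : V}
    (h : ∀ f : T.Dart, o ∉ side f → r f = ∞ → f.snd ≠ v ∧ f.fst ≠ v) : partner r o v = v := by
  rw [partner, dif_neg, dif_neg]
  · rintro ⟨f, h1, h2, h3⟩
    exact (h f h1 h2).2 h3
  · rintro ⟨f, h1, h2, h3⟩
    exact (h f h1 h2).1 h3

lemma partner_cases (r : T.Dart → OnePoint ℂ) (o v : V) :
    (∃ f : T.Dart, o ∉ side f ∧ r f = ∞ ∧ f.snd = v) ∨
    (∃ f : T.Dart, o ∉ side f ∧ r f = ∞ ∧ f.fst = v) ∨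
    ∀ f : T.Dart, o ∉ side f → r f = ∞ → f.snd ≠ v ∧ f.fst ≠ v := by
  by_contra! h
  obtain ⟨f, h1, h2, h3⟩ := h.2.2
  exact h.2.1 f h1 h2 (h3 (h.1 f h1 h2))

lemma partner_involutive (hT : T.IsTree) (hR : IsRatioSystem M r) :
    Function.Involutive (partner r o) := by
  intro v
  rcases partner_cases r o v with ⟨f, h1, h2, rfl⟩ | ⟨f, h1, h2, rfl⟩ | h
  · rw [partner_snd hT h1 h2, partner_fst hT hR h1 h2]
  · rw [partner_fst hT hR h1 h2, partner_snd hT h1 h2]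
  · rw [partner_eq_self h, partner_eq_self h]

/-- The diagonal entries of the middle factor. -/
noncomputable def pivot (M : L2 V →L[ℂ] L2 V) (r : T.Dart → OnePoint ℂ) (o v : V) : ℂ :=
  entry M v v + ∑ᶠ (f : T.Dart) (_ : f.fst = v ∧ o ∉ side f), coeff M f * finiteValue (r f)

open Classical in
/-- The off-diagonal entries of the middle factor. -/
noncomputable def offPivot (M : L2 V →L[ℂ] L2 V) (r : T.Dart → OnePoint ℂ) (o v : V) : ℂ :=
  if partner r o v = v then 0 else entry M v (partner r o v)

lemma pivot_eq (hlf : ∀ x : V, (T.neighborSet x).Finite) (v : V) :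
    pivot M r o v = entry M v v + ∑ f ∈ children hlf o v, coeff M f * finiteValue (r f) := by
  rw [pivot]
  congr 1
  exact finsum_mem_eq_finite_toFinset_sum _ (finite_children hlf o v)

lemma pivot_snd (hT : T.IsTree) (hlf : ∀ x : V, (T.neighborSet x).Finite)
    {e : T.Dart} (he : o ∉ side e) :
    pivot M r o e.snd = entry M e.snd e.snd
      + ∑ᶠ (f : T.Dart) (_ : Follows e f), coeff M f * finiteValue (r f) := by
  rw [pivot_eq hlf, children_eq hT he, finsum_follows hlf]

/-- This is the recursion solved for the pivot. For an infinite ratio the pivot vanishes, which is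
why such an edge needs a block of size two. -/
lemma pivot_snd_eq (hT : T.IsTree) (hlf : ∀ x : V, (T.neighborSet x).Finite)
    (hR : IsRatioSystem M r) {e : T.Dart} (he : o ∉ side e) (h0 : r e ≠ ((0 : ℂ) : OnePoint ℂ)) :
    pivot M r o e.snd = -divRatio (coeff M e.symm) (r e) := by
  rw [pivot_snd hT hlf he]
  linear_combination -hR.recursion e h0

lemma offPivot_of_self {v : V} (h : partner r o v = v) : offPivot M r o v = 0 := if_pos h

lemma offPivot_snd (hT : T.IsTree) {f : T.Dart} (hf : o ∉ side f) (hr : r f = ∞) :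
    offPivot M r o f.snd = coeff M f.symm := by
  rw [offPivot, partner_snd hT hf hr, if_neg f.fst_ne_snd]
  rfl

lemma offPivot_fst (hT : T.IsTree) (hR : IsRatioSystem M r) {f : T.Dart} (hf : o ∉ side f)
    (hr : r f = ∞) : offPivot M r o f.fst = coeff M f := by
  rw [offPivot, partner_fst hT hR hf hr, if_neg f.snd_ne_fst]
  rfl

/-! ### The factorization -/

/-- The factors of `M = (1 - Aᵀ) D (1 - A)`. -/
structure IsFactorization (M : L2 V →L[ℂ] L2 V) (r : T.Dart → OnePoint ℂ) (o : V)
    (E : V → T.Dart) (A B D : L2 V →L[ℂ] L2 V) : Prop where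
  lower : ∀ f y, A f y = stepWeight M r o E y * f (stepBack r o E y)
  upper : ∀ y, B (delta y) = delta y - stepWeight M r o E y • delta (stepBack r o E y)
  middle : ∀ f v, D f v = pivot M r o v * f v + offPivot M r o v * f (partner r o v)

namespace IsFactorization

variable {A B D : L2 V →L[ℂ] L2 V}

lemma middle_delta (hT : T.IsTree) (hR : IsRatioSystem M r) (h : IsFactorization M r o E A B D)
    (v : V) : D (delta v) = pivot M r o v • delta v
      + offPivot M r o (partner r o v) • delta (partner r o v) := by
  refine L2_ext fun x => ?_
  simp only [h.middle, lp.coeFn_add, Pi.add_apply, lp.coeFn_smul, Pi.smul_apply, smul_eq_mul]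
  have h1 : pivot M r o x * delta v x = pivot M r o v * delta v x := by
    by_cases hx : x = v
    · rw [hx]
    · rw [delta_of_ne hx, mul_zero, mul_zero]
  have h2 : offPivot M r o x * delta v (partner r o x) =
      offPivot M r o (partner r o v) * delta (partner r o v) x := by
    by_cases hx : x = partner r o v
    · rw [hx, delta_self, partner_involutive hT hR v, delta_self]
    · rw [delta_of_ne hx, delta_of_ne, mul_zero, mul_zero]
      rintro rfl
      exact hx (partner_involutive hT hR x).symm
  rw [h1, h2]

lemma middle_delta_of_self (hT : T.IsTree) (hR : IsRatioSystem M r)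
    (h : IsFactorization M r o E A B D) {v : V} (hv : partner r o v = v) :
    D (delta v) = pivot M r o v • delta v := by
  rw [h.middle_delta hT hR, hv, offPivot_of_self hv, zero_smul, add_zero]

lemma stepWeight_fst_of_infty (hT : T.IsTree) (hE : IsRooting o E) (hR : IsRatioSystem M r)
    {f : T.Dart} (hf : o ∉ side f) (hr : r f = ∞) : stepWeight M r o E f.fst = 0 := by
  by_cases ho : f.fst = o
  · rw [ho, stepWeight_root]
  · have h1 := (hR.infinite _ _ hr (hE.follows hT hf ho)).1
    have h2 := stepWeight_finite (M := M) (r := r) hT hE (hE.away _ ho)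
      (by rw [h1]; exact OnePoint.coe_ne_infty _)
    rwa [hE.snd _ ho, h1, finiteValue_coe] at h2

/-- The image under `(1 - Aᵀ) D` of the delta function at the head of an edge with infinite
ratio. -/
lemma apply_snd_infty (hT : T.IsTree) (hlf : ∀ x : V, (T.neighborSet x).Finite)
    (hE : IsRooting o E) (hR : IsRatioSystem M r) (h : IsFactorization M r o E A B D)
    {f : T.Dart} (hf : o ∉ side f) (hr : r f = ∞) :
    B (D (delta f.snd)) = coeff M f • delta f.fst := by
  have hp : pivot M r o f.snd = 0 := by
    rw [pivot_snd_eq hT hlf hR hf (by rw [hr]; exact OnePoint.infty_ne_coe _), hr, divRatio_infty,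
      neg_zero]
  rw [h.middle_delta hT hR, hp, zero_smul, zero_add, partner_snd hT hf hr,
    offPivot_fst hT hR hf hr, map_smul, h.upper, stepWeight_fst_of_infty hT hE hR hf hr, zero_smul,
    sub_zero]

/-- The head of such an edge has no partner, and the recursion turns `-pivot * r_e` into `m_{e⁻¹}`.
-/
lemma apply_snd_regular (hT : T.IsTree) (hlf : ∀ x : V, (T.neighborSet x).Finite)
    (hE : IsRooting o E) (hR : IsRatioSystem M r) (h : IsFactorization M r o E A B D)
    {e : T.Dart} (he : o ∉ side e) (hr : r e ≠ ∞) (h0 : r e ≠ ((0 : ℂ) : OnePoint ℂ)) :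
    B (D (delta e.snd)) = pivot M r o e.snd • delta e.snd + coeff M e.symm • delta e.fst := by
  have hself : partner r o e.snd = e.snd := by
    refine partner_eq_self fun f hf hfr => ⟨fun h1 => ?_, fun h1 => ?_⟩
    · rw [eq_of_away_of_snd_eq hT hf he h1] at hfr
      exact hr hfr
    · exact h0 (hR.infinite _ _ hfr (follows_of_away hT he hf h1.symm)).1
  rw [h.middle_delta_of_self hT hR hself, map_smul, h.upper, stepWeight_finite hT hE he hr,
    stepBack_finite hT hE he hr, smul_sub, smul_smul, sub_eq_add_neg, ← neg_smul]
  congr 2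
  have hz : finiteValue (r e) ≠ 0 := fun hz => (finiteValue_eq_zero hz).elim hr h0
  rw [pivot_snd_eq hT hlf hR he h0, ← coe_finiteValue hr, divRatio_coe, finiteValue_coe]
  field_simp

open Classical in
-- The product `(1 - Aᵀ) D` already has the entries of `M` towards the parent, and towards a child
-- across an edge with infinite ratio. The remaining entries come from `1 - A`.
lemma apply_delta (hT : T.IsTree) (hlf : ∀ x : V, (T.neighborSet x).Finite)
    (hE : IsRooting o E) (hR : IsRatioSystem M r) (h : IsFactorization M r o E A B D)
    (hM : IsOperatorOn ρ M) (v : V) :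
    B (D (delta v)) = pivot M r o v • delta v
      + (if v = o then 0 else coeff M (E v).symm • delta (E v).fst)
      + ∑ f ∈ children hlf o v, if r f = ∞ then coeff M f • delta f.snd else 0 := by
  by_cases hZ : ∃ f : T.Dart, f.fst = v ∧ o ∉ side f ∧ r f = ∞
  · obtain ⟨f, rfl, hf, hr⟩ := hZ
    rw [Finset.sum_eq_single_of_mem f (mem_children.2 ⟨rfl, hf⟩), if_pos hr,
      h.middle_delta hT hR, partner_fst hT hR hf hr, offPivot_snd hT hf hr, map_add, map_smul,
      map_smul, h.upper, h.upper, stepWeight_fst_of_infty hT hE hR hf hr, zero_smul, sub_zero,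
      hM.coeff_symm]
    · by_cases ho : f.fst = o
      · rw [if_pos ho, stepWeight_infty_root hT hE ho hr, zero_smul, sub_zero, add_zero]
      -- The weight of a jump is chosen so that, multiplied by `m_f`, it produces the entry of `M`
      -- at the parent of `v`.
      · have h1 := hE.follows hT hf ho
        rw [if_neg ho, stepWeight_infty hT hE (hE.away _ ho) h1 hr,
          stepBack_infty hT hE (hE.away _ ho) h1 hr, smul_sub, smul_smul, mul_neg,
          mul_div_cancel₀ _ (hM.coeff_ne_zero f), neg_smul, sub_neg_eq_add, add_assoc,
          add_comm (coeff M f • _)]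
    · intro f' hf' hne
      rw [mem_children] at hf'
      exact if_neg fun hr' => hne (hR.eq_of_infty hf'.1 hr' hr)
  · have hsum : (∑ f ∈ children hlf o v, if r f = ∞ then coeff M f • delta f.snd else 0) = 0 := by
      refine Finset.sum_eq_zero fun f hf => ?_
      rw [mem_children] at hf
      exact if_neg fun hr => hZ ⟨f, hf.1, hf.2, hr⟩
    rw [hsum, add_zero]
    by_cases ho : v = o
    · have hself : partner r o v = v := by
        refine partner_eq_self fun f hf hfr => ⟨fun h1 => ?_, fun h1 => hZ ⟨f, h1, hf, hfr⟩⟩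
        exact snd_ne_of_away hf (h1.trans ho)
      rw [if_pos ho, add_zero, h.middle_delta_of_self hT hR hself, map_smul, h.upper, ho,
        stepWeight_root, zero_smul, sub_zero]
    · have he := hE.away v ho
      have hv := hE.snd v ho
      rw [if_neg ho]
      by_cases hr : r (E v) = ∞
      · have h1 := h.apply_snd_infty hT hlf hE hR he hr
        have h2 := pivot_snd_eq hT hlf hR he (by rw [hr]; exact OnePoint.infty_ne_coe _)
        rw [hr, divRatio_infty, neg_zero] at h2
        rw [hv] at h1 h2
        rw [h1, h2, zero_smul, zero_add, hM.coeff_symm]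
      · by_cases h0 : r (E v) = ((0 : ℂ) : OnePoint ℂ)
        · obtain ⟨f, hf, hfr⟩ := hR.zero _ h0
          exact absurd ⟨f, hf.1.symm.trans hv, hf.away hT he, hfr⟩ hZ
        · have h1 := h.apply_snd_regular hT hlf hE hR he hr h0
          rwa [hv] at h1

end IsFactorization

end Factorization

/-! ### The columns of the lower factor and the product formula -/

section Factorization

variable {ρ : Γ →* (T ≃g T)} {M : L2 V →L[ℂ] L2 V} {r : T.Dart → OnePoint ℂ} {o : V}
  {E : V → T.Dart}

open Classical in
/-- The contribution of the edge `f` to the image under `A` of the delta function at its tail. -/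
noncomputable def stepImage (M : L2 V →L[ℂ] L2 V) (r : T.Dart → OnePoint ℂ)
    (hlf : ∀ x : V, (T.neighborSet x).Finite) (o : V) (E : V → T.Dart) (f : T.Dart) : L2 V :=
  finiteValue (r f) • delta f.snd + ∑ f' ∈ children hlf o f.snd,
    if r f' = ∞ then stepWeight M r o E f'.snd • delta f'.snd else 0

open Classical in
lemma delta_snd_of_away (hT : T.IsTree) {f f' : T.Dart} (hf : o ∉ side f) (hf' : o ∉ side f') :
    delta f.snd f'.snd = if f = f' then 1 else 0 := by
  split_ifs with h
  · rw [h, delta_self]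
  · exact delta_of_ne fun h' => h (eq_of_away_of_snd_eq hT hf hf' h'.symm)

lemma stepImage_root (hlf : ∀ x : V, (T.neighborSet x).Finite) {f : T.Dart} (hf : o ∉ side f) :
    stepImage M r hlf o E f o = 0 := by
  classical
  simp only [stepImage, lp.coeFn_add, Pi.add_apply, lp.coeFn_smul, Pi.smul_apply, smul_eq_mul,
    lp.coeFn_sum, Finset.sum_apply]
  rw [delta_of_ne (snd_ne_of_away hf).symm, mul_zero, zero_add]
  refine Finset.sum_eq_zero fun f' hf' => ?_
  rw [mem_children] at hf'
  split_ifs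
  · rw [lp.coeFn_smul, Pi.smul_apply, delta_of_ne (snd_ne_of_away hf'.2).symm, smul_zero]
  · rfl

open Classical in
lemma stepImage_snd (hT : T.IsTree) (hlf : ∀ x : V, (T.neighborSet x).Finite) {f f' : T.Dart}
    (hf : o ∉ side f) (hf' : o ∉ side f') : stepImage M r hlf o E f f'.snd =
      (if f = f' then finiteValue (r f') else 0)
      + if f.snd = f'.fst ∧ r f' = ∞ then stepWeight M r o E f'.snd else 0 := by
  simp only [stepImage, lp.coeFn_add, Pi.add_apply, lp.coeFn_smul, Pi.smul_apply, smul_eq_mul,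
    lp.coeFn_sum, Finset.sum_apply]
  rw [delta_snd_of_away hT hf hf']
  congr 1
  · split_ifs with h
    · rw [h, mul_one]
    · rw [mul_zero]
  · have h1 : ∀ f'' ∈ children hlf o f.snd,
        (if r f'' = ∞ then stepWeight M r o E f''.snd • delta f''.snd else 0 : L2 V) f'.snd =
        if f'' = f' then (if r f' = ∞ then stepWeight M r o E f'.snd else 0) else 0 := by
      intro f'' hf''
      rw [mem_children] at hf''
      split_ifs with h2 h3 h4 h5 h6
      · rw [h3, lp.coeFn_smul, Pi.smul_apply, delta_self, smul_eq_mul, mul_one]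
      · exact absurd (h3 ▸ h2) h4
      · rw [lp.coeFn_smul, Pi.smul_apply, delta_snd_of_away hT hf''.2 hf', if_neg h3, smul_zero]
      · exact absurd (h5 ▸ h6) h2
      · rfl
      · rfl
    rw [Finset.sum_congr rfl h1, Finset.sum_ite_eq']
    by_cases h : f'.fst = f.snd
    · rw [if_pos (mem_children.2 ⟨h, hf'⟩)]
      simp [h]
    · rw [if_neg (fun h' => h (mem_children.1 h').1), if_neg fun h' => h h'.1.symm]

namespace IsFactorization

variable {A B D : L2 V →L[ℂ] L2 V}

/-- A vertex reached from `v` with nonzero weight is a child or, by a jump, a grandchild;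
grandchildren are grouped under the child they jump over. -/
lemma lower_delta (hT : T.IsTree) (hlf : ∀ x : V, (T.neighborSet x).Finite)
    (hE : IsRooting o E) (h : IsFactorization M r o E A B D) (v : V) :
    A (delta v) = ∑ f ∈ children hlf o v, stepImage M r hlf o E f := by
  classical
  refine L2_ext fun y => ?_
  rw [h.lower, lp.coeFn_sum, Finset.sum_apply]
  rcases hE.cases hT r y with rfl | ⟨f', hf', hr, rfl⟩ | ⟨f', hf', hr, rfl⟩ | ⟨e, f', he, hef, hr, rfl⟩
  · rw [stepWeight_root, zero_mul]
    exact (Finset.sum_eq_zero fun f hf => stepImage_root hlf (mem_children.1 hf).2).symm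
  · rw [stepWeight_finite hT hE hf' hr, stepBack_finite hT hE hf' hr, Finset.sum_congr rfl
      fun f hf => stepImage_snd hT hlf (mem_children.1 hf).2 hf']
    simp only [hr, and_false, if_false, add_zero]
    rw [Finset.sum_ite_eq', delta_apply]
    simp [mem_children, hf']
  · have ha := away_of_fst_eq hf'
    rw [stepWeight_infty_root hT hE hf' hr, zero_mul, Finset.sum_congr rfl
      fun f hf => stepImage_snd hT hlf (mem_children.1 hf).2 ha]
    refine (Finset.sum_eq_zero fun f hf => ?_).symm
    rw [hr, finiteValue_infty, ite_self, zero_add, if_neg]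
    rintro ⟨h1, -⟩
    exact snd_ne_of_away (mem_children.1 hf).2 (h1.trans hf')
  · rw [stepBack_infty hT hE he hef hr, Finset.sum_congr rfl
      fun f hf => stepImage_snd hT hlf (mem_children.1 hf).2 (hef.away hT he)]
    have h1 : ∀ f ∈ children hlf o v, ((if f = f' then finiteValue (r f') else 0)
        + if f.snd = f'.fst ∧ r f' = ∞ then stepWeight M r o E f'.snd else 0) =
        if f = e then stepWeight M r o E f'.snd else 0 := by
      intro f hf
      rw [hr, finiteValue_infty, ite_self, zero_add, ← hef.1]
      refine if_congr ?_ rfl rfl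
      constructor
      · exact fun h2 => eq_of_away_of_snd_eq hT (mem_children.1 hf).2 he h2.1
      · rintro rfl
        exact ⟨rfl, rfl⟩
    rw [Finset.sum_congr rfl h1, Finset.sum_ite_eq', delta_apply]
    simp [mem_children, he]

open Classical in
-- The first term cancels the share of `f` in the pivot at its tail, and the second supplies the
-- missing entry of `M` at its head. If `r f = 0`, the second comes from the jump over the head of
-- `f`; if `r f = ∞`, that entry is already present in `apply_delta`.
lemma apply_stepImage (hT : T.IsTree) (hlf : ∀ x : V, (T.neighborSet x).Finite)
    (hE : IsRooting o E) (hR : IsRatioSystem M r) (h : IsFactorization M r o E A B D)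
    (hM : IsOperatorOn ρ M) {f : T.Dart} (hf : o ∉ side f) :
    B (D (stepImage M r hlf o E f)) = (coeff M f * finiteValue (r f)) • delta f.fst
      - if r f = ∞ then 0 else coeff M f • delta f.snd := by
  by_cases h0 : r f = ((0 : ℂ) : OnePoint ℂ)
  · obtain ⟨f', hff', hr'⟩ := hR.zero f h0
    have hf' := hff'.away hT hf
    have h1 : stepImage M r hlf o E f = stepWeight M r o E f'.snd • delta f'.snd := by
      rw [stepImage, h0, finiteValue_coe, zero_smul, zero_add,
        Finset.sum_eq_single_of_mem f' (mem_children.2 ⟨hff'.1.symm, hf'⟩), if_pos hr']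
      intro f'' hf'' hne
      exact if_neg fun hr'' =>
        hne (hR.eq_of_infty ((mem_children.1 hf'').1.trans hff'.1) hr'' hr')
    rw [h1, map_smul, map_smul, h.apply_snd_infty hT hlf hE hR hf' hr',
      stepWeight_infty hT hE hf hff' hr', h0, finiteValue_coe, mul_zero, zero_smul, zero_sub,
      if_neg (OnePoint.coe_ne_infty _), smul_smul, neg_mul, div_mul_cancel₀ _ (hM.coeff_ne_zero f'),
      neg_smul, hM.coeff_symm, hff'.1]
  · have h1 : stepImage M r hlf o E f = finiteValue (r f) • delta f.snd := by
      rw [stepImage, Finset.sum_eq_zero, add_zero]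
      intro f' hf'
      rw [mem_children] at hf'
      exact if_neg fun hr' => h0 (hR.infinite _ _ hr' (follows_of_away hT hf hf'.2 hf'.1.symm)).1
    rw [h1, map_smul, map_smul]
    by_cases hr : r f = ∞
    · rw [if_pos hr, hr, finiteValue_infty, zero_smul, mul_zero, zero_smul, sub_zero]
    · have hz : finiteValue (r f) ≠ 0 := fun hz => (finiteValue_eq_zero hz).elim hr h0
      have h2 : finiteValue (r f) * pivot M r o f.snd = -coeff M f := by
        rw [pivot_snd_eq hT hlf hR hf h0, ← coe_finiteValue hr, divRatio_coe, finiteValue_coe,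
          hM.coeff_symm]
        field_simp
      rw [if_neg hr, h.apply_snd_regular hT hlf hE hR hf hr h0, smul_add, smul_smul, smul_smul, h2,
        hM.coeff_symm, neg_smul, mul_comm (finiteValue _)]
      abel

/-- Compare columns: `apply_delta` gives the image of `δ_v`, and `apply_stepImage`, summed over the
child edges, gives the image of `A δ_v` to be subtracted. -/
lemma eq_mul (hT : T.IsTree) (hlf : ∀ x : V, (T.neighborSet x).Finite)
    (hE : IsRooting o E) (hR : IsRatioSystem M r) (h : IsFactorization M r o E A B D)
    (hM : IsOperatorOn ρ M) : M = B * D * (1 - A) := by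
  classical
  refine clm_ext fun v => ?_
  change M (delta v) = B (D (delta v - A (delta v)))
  rw [h.lower_delta hT hlf hE, map_sub, map_sub, map_sum, map_sum, Finset.sum_congr rfl
    fun f hf => h.apply_stepImage hT hlf hE hR hM (mem_children.1 hf).2,
    h.apply_delta hT hlf hE hR hM, Finset.sum_sub_distrib, pivot_eq hlf, hM.apply_delta hT hlf]
  have h1 : ∑ f ∈ children hlf o v, (coeff M f * finiteValue (r f)) • delta f.fst =
      (∑ f ∈ children hlf o v, coeff M f * finiteValue (r f)) • delta v := by
    rw [Finset.sum_smul]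
    exact Finset.sum_congr rfl fun f hf => by rw [(mem_children.1 hf).1]
  have h2 : ∑ y ∈ (hlf v).toFinset, entry M v y • delta y =
      (if v = o then 0 else coeff M (E v).symm • delta (E v).fst)
      + ∑ f ∈ children hlf o v, coeff M f • delta f.snd := by
    have h3 : ∑ f ∈ children hlf o v, coeff M f • delta f.snd =
        ∑ f ∈ children hlf o v, entry M v f.snd • delta f.snd :=
      Finset.sum_congr rfl fun f hf => by rw [← (mem_children.1 hf).1]; rfl
    rw [h3]
    by_cases ho : v = o
    · rw [if_pos ho, zero_add, ho]
      exact sum_neighbors_root hlf o fun y => entry M o y • delta y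
    · have h4 := sum_neighbors_eq hlf (E v) fun y => entry M v y • delta y
      have h5 := children_eq hT (hlf := hlf) (hE.away v ho)
      rw [hE.snd v ho] at h4 h5
      rw [if_neg ho, h4, h5]
      congr 2
      change _ = entry M (E v).snd (E v).fst
      rw [hE.snd v ho]
  have h6 : ∑ f ∈ children hlf o v, coeff M f • delta f.snd =
      (∑ f ∈ children hlf o v, if r f = ∞ then coeff M f • delta f.snd else 0)
      + ∑ f ∈ children hlf o v, if r f = ∞ then 0 else coeff M f • delta f.snd := by
    rw [← Finset.sum_add_distrib]
    refine Finset.sum_congr rfl fun f _ => ?_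
    split_ifs <;> simp
  rw [h1, h2, h6, add_smul]
  abel

end IsFactorization

end Factorization

/-! ### Uniform bounds and invertibility of the triangular factors -/

section Bounds

variable {ρ : Γ →* (T ≃g T)} {M : L2 V →L[ℂ] L2 V} {r : T.Dart → OnePoint ℂ}

lemma exists_edgeWeights [Finite (EdgeOrbit ρ)] (hlf : ∀ x : V, (T.neighborSet x).Finite)
    (hM : IsOperatorOn ρ M) (hr : IsRatioSystemOn ρ M r) (hα : decayRate ρ M r < 1) :
    ∃ (L : T.Dart → ℝ) (K θ : ℝ), (∀ e, 1 ≤ L e) ∧ (∀ e, L e ≤ K) ∧ 0 < θ ∧ θ < 1 ∧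
      ∀ e, r e ≠ ((0 : ℂ) : OnePoint ℂ) → ∀ S : Finset T.Dart,
        (∀ f ∈ S, r f ≠ ((0 : ℂ) : OnePoint ℂ)) → ∑ f ∈ S, edgeMatrix M r e f * L f ≤ θ * L e := by
  classical
  let _ := Fintype.ofFinite (NonzeroOrbit ρ r)
  obtain ⟨N, hN1, hN⟩ := exists_solution_of_spectralRadius_lt_one
    (R := realMatrix ρ M r) realMatrix_nonneg hα
  have hN0 : ∀ a, 0 ≤ N a := fun a => zero_le_one.trans (hN1 a)
  -- From `N ≤ K` one gets `N - 1 ≤ (1 - 1 / K) * N`; the summand `2` makes `θ = 1 - 1 / K`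
  -- positive.
  set K : ℝ := 2 + ∑ a, N a with hKdef
  have hKN : ∀ a, N a ≤ K := fun a =>
    (Finset.single_le_sum (fun b _ => hN0 b) (Finset.mem_univ a)).trans (by linarith)
  have hK2 : 2 ≤ K := by
    have := Finset.sum_nonneg fun a (_ : a ∈ Finset.univ) => hN0 a
    linarith
  have hK0 : 0 < K := by linarith
  have hKinv : 1 / K ≤ 1 / 2 := one_div_le_one_div_of_le two_pos hK2
  have hKpos : 0 < 1 / K := by positivity
  refine ⟨fun e => max 1 (liftNonzero hr N e), K, 1 - 1 / K, fun e => le_max_left _ _,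
    fun e => max_le (by linarith) ?_, by linarith, by linarith, fun e he S hS => ?_⟩
  · rw [liftNonzero]
    split_ifs
    · exact hKN _
    · linarith
  · have hL : ∀ f, r f ≠ ((0 : ℂ) : OnePoint ℂ) →
        max 1 (liftNonzero hr N f) = liftNonzero hr N f := fun f hf => by
      rw [liftNonzero_of_ne hr N hf]
      exact max_eq_right (hN1 _)
    have hnn : ∀ f, 0 ≤ edgeMatrix M r e f * liftNonzero hr N f := fun f => by
      refine mul_nonneg (edgeMatrix_nonneg M r e f) ?_
      rw [liftNonzero]
      split_ifs
      · exact hN0 _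
      · exact le_rfl
    calc ∑ f ∈ S, edgeMatrix M r e f * max 1 (liftNonzero hr N f)
        = ∑ f ∈ S, edgeMatrix M r e f * liftNonzero hr N f :=
          Finset.sum_congr rfl fun f hf => by rw [hL f (hS f hf)]
      _ = ∑ f ∈ S with f ∈ nearDarts hlf e, edgeMatrix M r e f * liftNonzero hr N f :=
          (Finset.sum_filter_of_ne fun f _ hne =>
            mem_nearDarts_of_ne (left_ne_zero_of_mul hne)).symm
      _ ≤ ∑ f ∈ nearDarts hlf e, edgeMatrix M r e f * liftNonzero hr N f :=
          Finset.sum_le_sum_of_subset_of_nonneg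
            (fun f hf => (Finset.mem_filter.1 hf).2) fun f _ _ => hnn f
      _ = N (nonzeroOrbit hr e he) - 1 := by
          rw [← sum_realMatrix hlf hM hr he, hN (nonzeroOrbit hr e he)]
          ring
      _ ≤ (1 - 1 / K) * max 1 (liftNonzero hr N e) := by
          rw [hL e he, liftNonzero_of_ne hr N he, sub_mul, one_mul]
          have : 1 / K * N (nonzeroOrbit hr e he) ≤ 1 := by
            rw [one_div, inv_mul_le_iff₀ hK0, mul_one]
            exact hKN _
          linarith

lemma exists_ratio_bound [Finite (EdgeOrbit ρ)] (hr : IsRatioSystemOn ρ M r) :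
    ∃ C : ℝ, 0 ≤ C ∧ ∀ e, ‖finiteValue (r e)‖ ≤ C := by
  obtain ⟨C, hC⟩ := bounded_of_invariant ρ (fun e => ‖finiteValue (r e)‖)
    fun g e => by rw [hr.map]
  exact ⟨max C 0, le_max_right _ _, fun e => (hC e).trans (le_max_left _ _)⟩

lemma exists_inv_coeff_bound [Finite (EdgeOrbit ρ)] (hM : IsOperatorOn ρ M) :
    ∃ C : ℝ, 0 ≤ C ∧ ∀ e : T.Dart, ‖(coeff M e)⁻¹‖ ≤ C := by
  obtain ⟨C, hC⟩ := bounded_of_invariant ρ (fun e : T.Dart => ‖(coeff M e)⁻¹‖)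
    fun g e => by rw [hM.coeff_map]
  exact ⟨max C 0, le_max_right _ _, fun e => (hC e).trans (le_max_left _ _)⟩

lemma exists_pivot_bound [Finite (EdgeOrbit ρ)] (hT : T.IsTree)
    (hlf : ∀ x : V, (T.neighborSet x).Finite) (hM : IsOperatorOn ρ M)
    (hr : IsRatioSystemOn ρ M r) {o : V} {E : V → T.Dart} (hE : IsRooting o E) :
    ∃ C : ℝ, ∀ v, ‖pivot M r o v‖ ≤ C := by
  obtain ⟨C, hC⟩ := bounded_of_invariant ρ (fun e => ‖entry M e.snd e.snd
    + ∑ᶠ (f : T.Dart) (_ : Follows e f), coeff M f * finiteValue (r f)‖) fun g e => by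
      rw [mapDart_snd, hM.invariant]
      congr 2
      refine (finsum_eq_of_bijective (dartEquiv (ρ g)) (dartEquiv (ρ g)).bijective fun d => ?_).symm
      simp only [dartEquiv_apply, follows_map, hM.coeff_map, hr.map]
  -- The pivot depends only on the orbit of the entering edge, except at the root, which has none
  -- and is bounded separately.
  refine ⟨max C ‖pivot M r o o‖, fun v => ?_⟩
  by_cases hv : v = o
  · rw [hv]
    exact le_max_right _ _
  · refine le_trans ?_ (le_max_left _ _)
    have := hC (E v)
    rwa [← pivot_snd hT hlf (hE.away v hv), hE.snd v hv] at this

lemma norm_offPivot_le (o v : V) : ‖offPivot M r o v‖ ≤ ‖M‖ := by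
  rw [offPivot]
  split_ifs
  · rw [norm_zero]; positivity
  · exact norm_entry_le M _ _

variable {o : V} {E : V → T.Dart}

lemma norm_stepWeight_le {C C' : ℝ} (hC : ∀ e, ‖finiteValue (r e)‖ ≤ C)
    (hC' : ∀ e : T.Dart, ‖(coeff M e)⁻¹‖ ≤ C') (h0 : 0 ≤ C) (h0' : 0 ≤ C') (y : V) :
    ‖stepWeight M r o E y‖ ≤ C + ‖M‖ * C' := by
  rw [stepWeight]
  split_ifs
  · rw [norm_zero]; positivity
  · rw [norm_zero]; positivity
  · rw [norm_neg, div_eq_mul_inv, norm_mul]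
    exact (mul_le_mul (norm_entry_le M _ _) (hC' (E y)) (norm_nonneg _) (norm_nonneg _)).trans
      (le_add_of_nonneg_left h0)
  · have : 0 ≤ ‖M‖ * C' := by positivity
    linarith [hC (E y)]

/-- The link between the factorization and `R`: the squared weight of a step is the entry of `R`
between the edges that enter its two ends, provided that it does not start at the root. -/
lemma stepWeight_spec (hT : T.IsTree) (hE : IsRooting o E) {y : V}
    (hy : stepWeight M r o E y ≠ 0) : y ≠ o ∧ r (E y) ≠ ((0 : ℂ) : OnePoint ℂ) ∧
      (stepBack r o E y ≠ o →
        edgeMatrix M r (E (stepBack r o E y)) (E y) = ‖stepWeight M r o E y‖ ^ 2) := by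
  rcases hE.cases hT r y with rfl | ⟨f, hf, hr, rfl⟩ | ⟨f, hf, hr, rfl⟩ | ⟨e, f, he, hef, hr, rfl⟩
  · exact absurd stepWeight_root hy
  · rw [stepWeight_finite hT hE hf hr] at hy
    rw [stepWeight_finite hT hE hf hr, stepBack_finite hT hE hf hr, hE.apply_snd hT hf]
    refine ⟨snd_ne_of_away hf, fun h0 => hy (by rw [h0, finiteValue_coe]), fun ho => ?_⟩
    exact edgeMatrix_of_follows hr (hE.follows hT hf ho)
  · exact absurd (stepWeight_infty_root hT hE hf hr) hy
  · have hf := hef.away hT he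
    rw [stepWeight_infty hT hE he hef hr, stepBack_infty hT hE he hef hr, hE.apply_snd hT hf,
      norm_neg]
    refine ⟨snd_ne_of_away hf, by rw [hr]; exact OnePoint.infty_ne_coe _, fun ho => ?_⟩
    exact edgeMatrix_of_infty hr (hE.follows hT he ho) hef

lemma stepBack_adj (hT : T.IsTree) (hE : IsRooting o E) {y : V}
    (hy : stepWeight M r o E y ≠ 0) : T.Adj (stepBack r o E y) y ∨
      ∃ z, T.Adj (stepBack r o E y) z ∧ T.Adj z y := by
  rcases hE.cases hT r y with rfl | ⟨f, hf, hr, rfl⟩ | ⟨f, hf, hr, rfl⟩ | ⟨e, f, he, hef, hr, rfl⟩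
  · exact absurd stepWeight_root hy
  · rw [stepBack_finite hT hE hf hr]
    exact Or.inl f.adj
  · exact absurd (stepWeight_infty_root hT hE hf hr) hy
  · rw [stepBack_infty hT hE he hef hr]
    exact Or.inr ⟨e.snd, e.adj, hef.adj⟩

/-- Only the moduli of the weights matter, so this serves both for `A` and, with conjugated weights,
for the transposed factor. The bounded degree limits the nonzero terms in a fibre of `stepBack` to
`d + d * d`, which gives the crude bound needed where `t` vanishes. -/
lemma exists_lower [Infinite V] [Finite (VertexOrbit ρ)] [Finite (EdgeOrbit ρ)] (hT : T.IsTree)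
    (hlf : ∀ x : V, (T.neighborSet x).Finite) (hM : IsOperatorOn ρ M)
    (hr : IsRatioSystemOn ρ M r) (hα : decayRate ρ M r < 1) (hE : IsRooting o E) {t : V → ℂ}
    (ht : ∀ y, ‖t y‖ = ‖stepWeight M r o E y‖) :
    ∃ A : L2 V →L[ℂ] L2 V, (∀ f y, A f y = t y * f (stepBack r o E y)) ∧ IsUnit (1 - A) := by
  classical
  obtain ⟨L, K, θ, hL1, hLK, hθ0, hθ1, hL⟩ := exists_edgeWeights hlf hM hr hα
  obtain ⟨d, hd⟩ := exists_degree_bound hlf ρ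
  obtain ⟨C, hC0, hC⟩ := exists_ratio_bound hr
  obtain ⟨C', hC0', hC'⟩ := exists_inv_coeff_bound hM
  set b : ℝ := C + ‖M‖ * C' with hb
  have hw : ∀ y, ‖t y‖ ≤ b := fun y => by
    rw [ht]
    exact norm_stepWeight_le hC hC' hC0 hC0' y
  have hb0 : 0 ≤ b := by positivity
  have hL0 : ∀ e, 0 ≤ L e := fun e => zero_le_one.trans (hL1 e)
  have hK0 : 0 ≤ K := (hL0 (E o)).trans (hLK _)
  have hnz : ∀ y, t y ≠ 0 → stepWeight M r o E y ≠ 0 := fun y hy => by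
    rw [← norm_ne_zero_iff, ← ht]
    exact norm_ne_zero_iff.2 hy
  have hfilter : ∀ F : Finset V, ∑ y ∈ F, ‖t y‖ ^ 2 * L (E y) =
      ∑ y ∈ F with t y ≠ 0, ‖t y‖ ^ 2 * L (E y) := by
    intro F
    refine (Finset.sum_filter_of_ne (p := fun y => t y ≠ 0) fun y _ hne h0 => hne ?_).symm
    rw [h0, norm_zero, zero_pow two_ne_zero, zero_mul]
  have hbound : ∀ (v : V) (F : Finset V), (∀ y ∈ F, stepBack r o E y = v) →
      ∑ y ∈ F, ‖t y‖ ^ 2 * L (E y) ≤ (d + d * d : ℕ) * (b ^ 2 * K) := by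
    intro v F hF
    rw [hfilter]
    have hsub : {y ∈ F | t y ≠ 0} ⊆
        (hlf v).toFinset ∪ (hlf v).toFinset.biUnion fun z => (hlf z).toFinset := by
      intro y hy
      obtain ⟨hyF, hy0⟩ := Finset.mem_filter.1 hy
      have hadj := stepBack_adj hT hE (hnz y hy0)
      rw [hF y hyF] at hadj
      simpa using hadj
    have hcard : {y ∈ F | t y ≠ 0}.card ≤ d + d * d :=
      calc {y ∈ F | t y ≠ 0}.card ≤ _ := Finset.card_le_card hsub
        _ ≤ (hlf v).toFinset.card + ((hlf v).toFinset.biUnion fun z => (hlf z).toFinset).card :=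
          Finset.card_union_le _ _
        _ ≤ d + d * d := add_le_add (hd v) ((Finset.card_biUnion_le_card_mul _ _ d
          fun z _ => hd z).trans (Nat.mul_le_mul_right _ (hd v)))
    calc ∑ y ∈ F with t y ≠ 0, ‖t y‖ ^ 2 * L (E y)
        ≤ {y ∈ F | t y ≠ 0}.card • (b ^ 2 * K) := Finset.sum_le_card_nsmul _ _ _ fun y _ =>
          mul_le_mul (pow_le_pow_left₀ (norm_nonneg _) (hw y) 2) (hLK _) (hL0 _) (by positivity)
      _ ≤ (d + d * d : ℕ) * (b ^ 2 * K) := by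
          rw [nsmul_eq_mul]
          gcongr
  obtain ⟨A, hA, -⟩ := exists_weightedComp t (stepBack r o E)
    (C := (d + d * d : ℕ) * (b ^ 2 * K)) (by positivity) fun v F hF =>
      le_trans (Finset.sum_le_sum fun y _ => le_mul_of_one_le_right (sq_nonneg _) (hL1 _))
        (hbound v F hF)
  refine ⟨A, hA, isUnit_one_sub_of_weights' (N := fun y => L (E y)) (fun y => hL1 _)
    (fun y => hLK _) hθ0 hθ1 (C := (d + d * d : ℕ) * (b ^ 2 * K)) (by positivity) hbound
    (fun v F hv hF => ?_) hA⟩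
  -- A nonzero weight at `v` ensures that `v` is entered by an edge with nonzero ratio, so that `R`
  -- has a row for it.
  obtain ⟨hvo, hrv, -⟩ := stepWeight_spec hT hE (hnz v hv)
  rw [hfilter]
  have hspec : ∀ y ∈ F.filter (fun y => t y ≠ 0), y ≠ o ∧ r (E y) ≠ ((0 : ℂ) : OnePoint ℂ) ∧
      edgeMatrix M r (E v) (E y) = ‖t y‖ ^ 2 := by
    intro y hy
    obtain ⟨hyF, hy0⟩ := Finset.mem_filter.1 hy
    obtain ⟨h1, h2, h3⟩ := stepWeight_spec hT hE (hnz y hy0)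
    rw [hF y hyF, ← ht] at h3
    exact ⟨h1, h2, h3 hvo⟩
  have hinj : Set.InjOn E (F.filter fun y => t y ≠ 0 : Finset V) := by
    intro y hy y' hy' h
    rw [← hE.snd y (hspec y hy).1, ← hE.snd y' (hspec y' hy').1, h]
  have h1 := hL (E v) hrv ((F.filter fun y => t y ≠ 0).image E) (by
    intro f hf
    obtain ⟨y, hy, rfl⟩ := Finset.mem_image.1 hf
    exact (hspec y hy).2.1)
  rw [Finset.sum_image hinj] at h1
  rwa [Finset.sum_congr rfl fun y hy => by rw [(hspec y hy).2.2]] at h1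

lemma exists_isFactorization [Infinite V] [Finite (VertexOrbit ρ)] [Finite (EdgeOrbit ρ)]
    (hT : T.IsTree) (hlf : ∀ x : V, (T.neighborSet x).Finite) (hM : IsOperatorOn ρ M)
    (hr : IsRatioSystemOn ρ M r) (hα : decayRate ρ M r < 1) (hE : IsRooting o E) :
    ∃ A B D : L2 V →L[ℂ] L2 V, IsFactorization M r o E A B D ∧ IsUnit (1 - A) ∧ IsUnit B := by
  obtain ⟨A, hA, hAu⟩ := exists_lower hT hlf hM hr hα hE (fun _ => rfl)
  obtain ⟨A', hA', hAu'⟩ := exists_lower hT hlf hM hr hα hE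
    (t := fun y => star (stepWeight M r o E y)) (fun _ => norm_star _)
  obtain ⟨C, hC⟩ := exists_pivot_bound hT hlf hM hr hE
  obtain ⟨D, hD⟩ := exists_pairOperator (partner_involutive (o := o) hT hr.isRatioSystem)
    (K := max C ‖M‖) (fun v => (hC v).trans (le_max_left _ _))
    (fun v => (norm_offPivot_le (M := M) (r := r) o v).trans (le_max_right _ _))
  refine ⟨A, _, D, ⟨hA, fun y => ?_, hD⟩, hAu, isUnit_one_sub_adjoint hAu'⟩
  rw [sub_apply, adjoint_weightedComp_delta hA']
  rfl

end Bounds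

/-! ### The middle factor and the ratios of the Green function -/

section Middle

variable {ρ : Γ →* (T ≃g T)} {M : L2 V →L[ℂ] L2 V} {r : T.Dart → OnePoint ℂ} {o : V}
  {E : V → T.Dart}

lemma ratio_of_self (hT : T.IsTree) (hE : IsRooting o E) (hR : IsRatioSystem M r) {v : V} (hv : v ≠ o)
    (hself : ∀ f : T.Dart, o ∉ side f → r f = ∞ → f.snd ≠ v ∧ f.fst ≠ v) :
    r (E v) ≠ ∞ ∧ r (E v) ≠ ((0 : ℂ) : OnePoint ℂ) := by
  have he := hE.away v hv
  refine ⟨fun h => (hself _ he h).1 (hE.snd v hv), fun h => ?_⟩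
  obtain ⟨f, hf, hfr⟩ := hR.zero _ h
  exact (hself f (hf.away hT he) hfr).2 (hf.1.symm.trans (hE.snd v hv))

/-- The inverse of the pivot at a vertex other than the root that has no partner. -/
lemma pivot_mul_eq (hT : T.IsTree) (hlf : ∀ x : V, (T.neighborSet x).Finite)
    (hM : IsOperatorOn ρ M) (hE : IsRooting o E) (hR : IsRatioSystem M r) {v : V} (hv : v ≠ o)
    (hself : ∀ f : T.Dart, o ∉ side f → r f = ∞ → f.snd ≠ v ∧ f.fst ≠ v) :
    pivot M r o v * -(finiteValue (r (E v)) * (coeff M (E v).symm)⁻¹) = 1 := by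
  obtain ⟨h1, h2⟩ := ratio_of_self hT hE hR hv hself
  have h3 := pivot_snd_eq hT hlf hR (hE.away v hv) h2
  have hz : finiteValue (r (E v)) ≠ 0 := fun hz => (finiteValue_eq_zero hz).elim h1 h2
  have hc := hM.coeff_ne_zero (E v).symm
  rw [hE.snd v hv, ← coe_finiteValue h1, divRatio_coe] at h3
  rw [h3]
  field_simp

lemma pivot_snd_infty (hT : T.IsTree) (hlf : ∀ x : V, (T.neighborSet x).Finite)
    (hR : IsRatioSystem M r) {f : T.Dart} (hf : o ∉ side f) (hr : r f = ∞) :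
    pivot M r o f.snd = 0 := by
  rw [pivot_snd_eq hT hlf hR hf (by rw [hr]; exact OnePoint.infty_ne_coe _), hr, divRatio_infty,
    neg_zero]

namespace IsFactorization

variable {A B D : L2 V →L[ℂ] L2 V}

lemma isUnit_middle [Finite (EdgeOrbit ρ)] (hT : T.IsTree)
    (hlf : ∀ x : V, (T.neighborSet x).Finite) (hM : IsOperatorOn ρ M)
    (hr : IsRatioSystemOn ρ M r) (hE : IsRooting o E) (h : IsFactorization M r o E A B D)
    (ho : (∃ f : T.Dart, f.fst = o ∧ r f = ∞) ∨ pivot M r o o ≠ 0) : IsUnit D := by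
  have : Nonempty V := ⟨o⟩
  have hR := hr.isRatioSystem
  obtain ⟨C, hC⟩ := exists_pivot_bound hT hlf hM hr hE
  obtain ⟨C₁, hC₁0, hC₁⟩ := exists_ratio_bound hr
  obtain ⟨C₂, hC₂0, hC₂⟩ := exists_inv_coeff_bound hM
  -- Squares appear because a vertex without partner is a fixed point of the involution, with
  -- determinant the square of its pivot.
  set K : ℝ := C₂ ^ 2 + (C₁ * C₂) ^ 2 + ‖(pivot M r o o)⁻¹‖ ^ 2 with hK
  have key : ∀ v, ∃ z : ℂ, (pivot M r o v * pivot M r o (partner r o v)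
      - offPivot M r o v * offPivot M r o (partner r o v)) * z = 1 ∧ ‖z‖ ≤ K := by
    intro v
    have hedge : ∀ f : T.Dart, ‖-(coeff M f)⁻¹ ^ 2‖ ≤ K := by
      intro f
      rw [norm_neg, norm_pow]
      have h1 : ‖(coeff M f)⁻¹‖ ^ 2 ≤ C₂ ^ 2 := pow_le_pow_left₀ (norm_nonneg _) (hC₂ f) 2
      have h2 := sq_nonneg (C₁ * C₂)
      have h3 := sq_nonneg ‖(pivot M r o o)⁻¹‖
      linarith
    rcases partner_cases r o v with ⟨f, hf, hfr, rfl⟩ | ⟨f, hf, hfr, rfl⟩ | hself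
    · refine ⟨-(coeff M f)⁻¹ ^ 2, ?_, hedge f⟩
      have hc := hM.coeff_ne_zero f
      rw [partner_snd hT hf hfr, offPivot_snd hT hf hfr, offPivot_fst hT hR hf hfr,
        pivot_snd_infty hT hlf hR hf hfr, hM.coeff_symm]
      field_simp
      ring
    · refine ⟨-(coeff M f)⁻¹ ^ 2, ?_, hedge f⟩
      have hc := hM.coeff_ne_zero f
      rw [partner_fst hT hR hf hfr, offPivot_snd hT hf hfr, offPivot_fst hT hR hf hfr,
        pivot_snd_infty hT hlf hR hf hfr, hM.coeff_symm]
      field_simp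
      ring
    · rw [partner_eq_self hself, offPivot_of_self (partner_eq_self hself)]
      by_cases hv : v = o
      · subst hv
        have hp : pivot M r v v ≠ 0 := ho.resolve_left fun ⟨f, hf, hfr⟩ =>
          (hself f (away_of_fst_eq hf) hfr).2 hf
        refine ⟨(pivot M r v v)⁻¹ ^ 2, by field_simp; ring, ?_⟩
        rw [norm_pow, hK]
        have h1 := sq_nonneg C₂
        have h2 := sq_nonneg (C₁ * C₂)
        linarith
      · have h1 := pivot_mul_eq hT hlf hM hE hR hv hself
        refine ⟨(-(finiteValue (r (E v)) * (coeff M (E v).symm)⁻¹)) ^ 2, ?_, ?_⟩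
        · rw [mul_zero, sub_zero, ← sq, ← mul_pow, h1, one_pow]
        · rw [norm_pow, norm_neg, norm_mul]
          have h2 : (‖finiteValue (r (E v))‖ * ‖(coeff M (E v).symm)⁻¹‖) ^ 2 ≤ (C₁ * C₂) ^ 2 := by
            gcongr
            · exact hC₁ _
            · exact hC₂ _
          have h3 := sq_nonneg C₂
          have h4 := sq_nonneg ‖(pivot M r o o)⁻¹‖
          linarith
  refine isUnit_pairOperator (partner_involutive (o := o) hT hR) (K := max C ‖M‖) (K' := K)
    (fun v => (hC v).trans (le_max_left _ _))
    (fun v => (norm_offPivot_le (M := M) (r := r) o v).trans (le_max_right _ _))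
    (fun v h0 => ?_) (fun v => ?_) h.middle
  · obtain ⟨z, hz, -⟩ := key v
    rw [h0, zero_mul] at hz
    exact zero_ne_one hz
  · obtain ⟨z, hz, hzK⟩ := key v
    rwa [inv_eq_of_mul_eq_one_right hz]

lemma apply_delta_root (h : IsFactorization M r o E A B D) : B (delta o) = delta o := by
  rw [h.upper, stepWeight_root, zero_smul, sub_zero]

/-- The vector `(1 - A) G(o, ·)` is mapped to `δ_o` by the middle factor. -/
lemma middle_green (hT : T.IsTree) (hlf : ∀ x : V, (T.neighborSet x).Finite)
    (hM : IsOperatorOn ρ M) (hR : IsRatioSystem M r) (hE : IsRooting o E)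
    (h : IsFactorization M r o E A B D) (hB : IsUnit B) (hU : IsUnit M) :
    D (greenCol M o - A (greenCol M o)) = delta o := by
  refine eq_of_apply_eq hB ?_
  rw [h.apply_delta_root]
  have h1 := congrArg (fun N : L2 V →L[ℂ] L2 V => N (greenCol M o)) (h.eq_mul hT hlf hE hR hM)
  exact h1.symm.trans (apply_greenCol hU o)

/-- Put `k = (1 - A) G(o,·)`, so `D k = δ_o`. The row at the head of an edge with infinite ratio
kills `k` at its tail, and the row of an unpartnered vertex other than the root kills `k` there. By
the definition of `A`, these zeros are exactly the asserted relations. -/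
lemma green_of_away (hT : T.IsTree) (hlf : ∀ x : V, (T.neighborSet x).Finite)
    (hM : IsOperatorOn ρ M) (hR : IsRatioSystem M r) (hE : IsRooting o E)
    (h : IsFactorization M r o E A B D) (hB : IsUnit B) (hU : IsUnit M) {e : T.Dart}
    (he : o ∉ side e) :
    (r e = ∞ → greenCol M o e.fst = 0) ∧
      (r e ≠ ∞ → greenCol M o e.snd = finiteValue (r e) * greenCol M o e.fst) := by
  set k : L2 V := greenCol M o - A (greenCol M o) with hk
  have hkapp : ∀ y, k y = greenCol M o y
      - stepWeight M r o E y * greenCol M o (stepBack r o E y) := fun y => by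
    rw [hk, lp.coeFn_sub, Pi.sub_apply, h.lower]
  have hD : ∀ v, pivot M r o v * k v + offPivot M r o v * k (partner r o v) = delta o v := by
    intro v
    rw [← h.middle, h.middle_green hT hlf hM hR hE hB hU]
  have hfst : ∀ f : T.Dart, o ∉ side f → r f = ∞ → k f.fst = 0 := by
    intro f hf hfr
    have h1 := hD f.snd
    rw [pivot_snd_infty hT hlf hR hf hfr, zero_mul, zero_add, offPivot_snd hT hf hfr,
      partner_snd hT hf hfr, delta_of_ne (snd_ne_of_away hf)] at h1
    exact (mul_eq_zero.1 h1).resolve_left (hM.coeff_ne_zero _)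
  constructor
  · intro hr
    have h1 := hkapp e.fst
    rw [hfst e he hr, stepWeight_fst_of_infty hT hE hR he hr, zero_mul, sub_zero] at h1
    exact h1.symm
  · intro hr
    have h1 := hkapp e.snd
    rw [stepWeight_finite hT hE he hr, stepBack_finite hT hE he hr] at h1
    have h2 : k e.snd = 0 := by
      rcases partner_cases r o e.snd with ⟨f, hf, hfr, hfe⟩ | ⟨f, hf, hfr, hfe⟩ | hself
      · rw [eq_of_away_of_snd_eq hT hf he hfe] at hfr
        exact absurd hfr hr
      · rw [← hfe]
        exact hfst f hf hfr
      · have h3 := hD e.snd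
        rw [offPivot_of_self (partner_eq_self hself), zero_mul, add_zero,
          delta_of_ne (snd_ne_of_away he)] at h3
        refine (mul_eq_zero.1 h3).resolve_left fun h4 => ?_
        have h5 := pivot_mul_eq hT hlf hM hE hR (snd_ne_of_away he) hself
        rw [h4, zero_mul] at h5
        exact zero_ne_one h5
    rw [h2] at h1
    exact (sub_eq_zero.1 h1.symm)

end IsFactorization

end Middle

/-! ### Decay rate less than one -/

section Decay

variable {ρ : Γ →* (T ≃g T)} {M : L2 V →L[ℂ] L2 V} {r : T.Dart → OnePoint ℂ}

/-- For every source `x` on the tail side of `e`, the factorization rooted at `x` itself gives the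
ratio on `e`. -/
lemma arisesFromGreen_of_decayRate [Infinite V] [Finite (VertexOrbit ρ)] [Finite (EdgeOrbit ρ)]
    (hT : T.IsTree) (hlf : ∀ x : V, (T.neighborSet x).Finite) (hM : IsOperatorOn ρ M)
    (hr : IsRatioSystemOn ρ M r) (hα : decayRate ρ M r < 1) (hU : IsUnit M) :
    ArisesFromGreen M r := by
  intro e
  obtain ⟨w, hw, hne⟩ := exists_green_ne_zero hT hlf hM hU e
  refine ⟨⟨w, (between_iff_not_mem_side hT).2 hw, hne⟩, fun x hx hx0 => ?_⟩
  obtain ⟨E, hE⟩ := exists_isRooting hT x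
  obtain ⟨A, B, D, h, -, hB⟩ := exists_isFactorization hT hlf hM hr hα hE
  obtain ⟨h1, h2⟩ := h.green_of_away hT hlf hM hr.isRatioSystem hE hB hU
    ((between_iff_not_mem_side hT).1 hx)
  rw [← green_eq hM hU] at h1
  rw [← green_eq hM hU, ← green_eq hM hU] at h2
  by_cases hr' : r e = ∞
  · rw [h1 hr', hr', genRatio_zero]
  · have h3 : green M x e.fst ≠ 0 := by
      intro h0
      rw [h2 hr', h0, mul_zero] at hx0
      simp at hx0
    rw [genRatio_of_ne h3, h2 hr', mul_div_cancel_right₀ _ h3, coe_finiteValue hr']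

/-- A square summable function whose ratios along the edges are invariant and never vanish
does not exist. -/
lemma false_of_invariant_ratios [Infinite V] [Finite (VertexOrbit ρ)] (hT : T.IsTree) {o : V}
    {h : L2 V} (ho : h o = 1) {z : T.Dart → ℂ} (hz0 : ∀ e, z e ≠ 0)
    (hz : ∀ g e, z (mapDart (ρ g) e) = z e) (hh : ∀ e, h e.snd = z e * h e.fst) : False := by
  have hwalk : ∀ {x y : V} (p : T.Walk x y), h x ≠ 0 → h y ≠ 0 := by
    intro x y p
    induction p with
    | nil => exact id
    | cons hadj p ih =>
      rename_i a b c
      intro hx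
      refine ih ?_
      have h1 : h b = _ * h a := hh ⟨(a, b), hadj⟩
      rw [h1]
      exact mul_ne_zero (hz0 _) hx
  have hne : ∀ x, h x ≠ 0 := fun x =>
    hwalk (hT.connected o x).some (by rw [ho]; exact one_ne_zero)
  have hmul : ∀ (g : Γ) {x y : V} (p : T.Walk x y),
      h (ρ g x) = h (ρ g o) * h x → h (ρ g y) = h (ρ g o) * h y := by
    intro g x y p
    induction p with
    | nil => exact id
    | cons hadj p ih =>
      rename_i a b c
      intro hx
      refine ih ?_
      have h1 := hh ⟨(a, b), hadj⟩
      have h2 := hh (mapDart (ρ g) ⟨(a, b), hadj⟩)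
      rw [hz] at h2
      change h b = _ * h a at h1
      change h (ρ g b) = _ * h (ρ g a) at h2
      rw [h2, hx, h1]
      ring
  have hmul' : ∀ g x, h (ρ g x) = h (ρ g o) * h x := fun g x =>
    hmul g (hT.connected o x).some (by rw [ho, mul_one])
  -- An automorphism preserves the sum of squares, while by `hmul'` it multiplies this sum by `‖h (ρ
  -- g o)‖ ^ 2`.
  have hnorm : ∀ g, ‖h (ρ g o)‖ = 1 := by
    intro g
    have h1 : ∑' x, ‖h (ρ g x)‖ ^ 2 = ∑' x, ‖h x‖ ^ 2 :=
      Equiv.tsum_eq (ρ g).toEquiv fun x => ‖h x‖ ^ 2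
    have h4 : ∀ x, ‖h (ρ g x)‖ ^ 2 = ‖h (ρ g o)‖ ^ 2 * ‖h x‖ ^ 2 := fun x => by
      rw [hmul' g x, norm_mul, mul_pow]
    rw [tsum_congr h4, tsum_mul_left, ← norm_sq_eq_tsum] at h1
    have h2 : ‖h‖ ^ 2 ≠ 0 := by
      refine pow_ne_zero 2 (norm_ne_zero_iff.2 fun h0 => hne o ?_)
      rw [h0]
      rfl
    have h3 : ‖h (ρ g o)‖ ^ 2 = 1 := mul_right_cancel₀ h2 (by rw [h1, one_mul])
    exact (pow_eq_one_iff_of_nonneg (norm_nonneg _) two_ne_zero).1 h3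
  have horb : ∀ x, ∃ a : VertexOrbit ρ, ‖h x‖ = ‖h (Quotient.out a)‖ := by
    intro x
    obtain ⟨g, hg⟩ := Quotient.exact (Quotient.out_eq (s := vertexSetoid ρ) (Quotient.mk _ x))
    refine ⟨Quotient.mk _ x, ?_⟩
    conv_lhs => rw [← hg]
    rw [hmul', norm_mul, hnorm, one_mul]
  have : Nonempty (VertexOrbit ρ) := ⟨Quotient.mk _ o⟩
  obtain ⟨a, ha⟩ := Finite.exists_min fun a : VertexOrbit ρ => ‖h (Quotient.out a)‖
  have hpos : 0 < ‖h (Quotient.out a)‖ ^ 2 := by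
    have := hne (Quotient.out a)
    positivity
  -- Summability over the infinite set `V` forces values below the positive minimum over the orbits.
  have hev := (summable_norm_sq h).tendsto_cofinite_zero.eventually (gt_mem_nhds hpos)
  obtain ⟨x, hx⟩ := hev.exists
  obtain ⟨b, hb⟩ := horb x
  rw [hb] at hx
  exact absurd hx (not_lt.2 (pow_le_pow_left₀ (norm_nonneg _) (ha b) 2))

lemma children_snd (hlf : ∀ x : V, (T.neighborSet x).Finite) (e : T.Dart)
    {F : Type*} [AddCommMonoid F] (φ : T.Dart → F) :
    ∑ f ∈ children hlf e.snd e.snd, φ f = φ e.symm + ∑ f ∈ nextDarts hlf e, φ f := by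
  classical
  have h : children hlf e.snd e.snd = insert e.symm (nextDarts hlf e) := by
    ext f
    rw [mem_children, Finset.mem_insert, mem_nextDarts]
    constructor
    · intro hf
      by_cases hfe : f = e.symm
      · exact Or.inl hfe
      · exact Or.inr ⟨hf.1.symm, hfe⟩
    · rintro (rfl | hf)
      · exact ⟨rfl, away_of_fst_eq rfl⟩
      · exact ⟨hf.1.symm, away_of_fst_eq hf.1.symm⟩
  rw [h, Finset.sum_insert]
  rw [mem_nextDarts]
  exact fun h' => h'.2 rfl

/-- Some root has a nonvanishing pivot. -/
lemma exists_root [Infinite V] [Finite (VertexOrbit ρ)] [Finite (EdgeOrbit ρ)]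
    (hT : T.IsTree) (hlf : ∀ x : V, (T.neighborSet x).Finite) (hM : IsOperatorOn ρ M)
    (hr : IsRatioSystemOn ρ M r) (hα : decayRate ρ M r < 1) :
    ∃ o : V, (∃ f : T.Dart, f.fst = o ∧ r f = ∞) ∨ pivot M r o o ≠ 0 := by
  by_contra! hno
  have hR := hr.isRatioSystem
  have hinf : ∀ f, r f ≠ ∞ := fun f => (hno f.fst).1 f rfl
  have hzero : ∀ e, r e ≠ ((0 : ℂ) : OnePoint ℂ) := fun e he => by
    obtain ⟨f, -, hf⟩ := hR.zero e he
    exact hinf f hf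
  have hz0 : ∀ e, finiteValue (r e) ≠ 0 := fun e hz =>
    (finiteValue_eq_zero hz).elim (hinf e) (hzero e)
  -- The vanishing pivot at `e.snd`, taken as root, and the recursion for `e` differ only in the
  -- term of the edge back to `e.fst`.
  have hsymm : ∀ e, finiteValue (r e.symm) * finiteValue (r e) = 1 := by
    intro e
    have h1 := (hno e.snd).2
    have h2 := hR.recursion e (hzero e)
    rw [pivot_eq hlf, children_snd hlf e fun f => coeff M f * finiteValue (r f)] at h1
    rw [finsum_follows hlf, ← coe_finiteValue (hinf e), divRatio_coe] at h2
    have hc := hM.coeff_ne_zero e.symm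
    have hz := hz0 e
    have h3 : coeff M e.symm * finiteValue (r e.symm) = coeff M e.symm / finiteValue (r e) := by
      linear_combination h1 + h2
    rw [eq_div_iff hz, mul_assoc] at h3
    exact mul_left_cancel₀ hc (h3.trans (mul_one _).symm)
  obtain ⟨o⟩ : Nonempty V := inferInstance
  obtain ⟨E, hE⟩ := exists_isRooting hT o
  obtain ⟨A, B, D, h, hA, -⟩ := exists_isFactorization hT hlf hM hr hα hE
  -- The equation `(1 - A) k = δ_o` propagates the value `1` outwards from the root by the ratios;
  -- `hsymm` extends the relation to edges pointing towards the root.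
  let k : L2 V := Ring.inverse (1 - A) (delta o)
  have hk : ∀ y, k y = delta o y + stepWeight M r o E y * k (stepBack r o E y) := by
    intro y
    have h1 : k - A k = delta o := by
      exact congrArg (fun A : L2 V →L[ℂ] L2 V => A (delta o)) (Ring.mul_inverse_cancel _ hA)
    rw [← h.lower, ← h1, lp.coeFn_sub, Pi.sub_apply]
    ring
  have haway : ∀ e : T.Dart, o ∉ side e → k e.snd = finiteValue (r e) * k e.fst := by
    intro e he
    rw [hk, delta_of_ne (snd_ne_of_away he), stepWeight_finite hT hE he (hinf e),
      stepBack_finite hT hE he (hinf e), zero_add]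
  refine false_of_invariant_ratios (ρ := ρ) hT (o := o) (h := k) ?_ hz0
    (fun g e => by rw [hr.map]) fun e => ?_
  · rw [hk, delta_self, stepWeight_root, zero_mul, add_zero]
  · by_cases he : o ∈ side e
    · have h1 := haway e.symm (by rw [mem_side_symm hT]; exact not_not.2 he)
      change k e.fst = _ * k e.snd at h1
      rw [h1, ← mul_assoc, mul_comm (finiteValue _), hsymm, one_mul]
    · exact haway e he

lemma isUnit_of_decayRate [Infinite V] [Finite (VertexOrbit ρ)] [Finite (EdgeOrbit ρ)]
    (hT : T.IsTree) (hlf : ∀ x : V, (T.neighborSet x).Finite) (hM : IsOperatorOn ρ M)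
    (hr : IsRatioSystemOn ρ M r) (hα : decayRate ρ M r < 1) : IsUnit M := by
  obtain ⟨o, ho⟩ := exists_root hT hlf hM hr hα
  obtain ⟨E, hE⟩ := exists_isRooting hT o
  obtain ⟨A, B, D, h, hA, hB⟩ := exists_isFactorization hT hlf hM hr hα hE
  rw [h.eq_mul hT hlf hE hr.isRatioSystem hM]
  exact (hB.mul (h.isUnit_middle hT hlf hM hr hE ho)).mul hA

end Decay

end TreeQuotient

theorem mainTheorem7 {V : Type*} [Infinite V] (T : SimpleGraph V) (hT : T.IsTree)
    (hlf : ∀ x : V, (T.neighborSet x).Finite)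
    {Γ : Type*} [Group Γ] (ρ : Γ →* (T ≃g T))
    [Finite (TreeQuotient.VertexOrbit ρ)] [Finite (TreeQuotient.EdgeOrbit ρ)] :
    TreeQuotient.IsClassifyingCondition ρ
      (fun r M => TreeQuotient.decayRate ρ M r < 1) ∧
    ∀ M : TreeQuotient.L2 V →L[ℂ] TreeQuotient.L2 V, TreeQuotient.IsOperatorOn ρ M →
      (IsUnit M ↔ ∃ r : T.Dart → OnePoint ℂ,
        TreeQuotient.IsRatioSystemOn ρ M r ∧ TreeQuotient.decayRate ρ M r < 1) := by
  refine ⟨fun M hM r hr => ⟨fun hα => ?_, fun h => h.2.decayRate_lt_one hT hlf hM h.1⟩,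
    fun M hM => ⟨fun hU => ?_, fun ⟨r, hr, hα⟩ =>
      TreeQuotient.isUnit_of_decayRate hT hlf hM hr hα⟩⟩
  · have hU := TreeQuotient.isUnit_of_decayRate hT hlf hM hr hα
    exact ⟨hU, TreeQuotient.arisesFromGreen_of_decayRate hT hlf hM hr hα hU⟩
  · obtain ⟨r, h⟩ := TreeQuotient.exists_arisesFromGreen hT hlf hM hU
    exact ⟨r, h.isRatioSystemOn hT hlf hM hU, h.decayRate_lt_one hT hlf hM hU⟩
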